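/- **Setting.** Let $(\Omega,\mathcal F,\mathbb P)$ be a probability space, $\mathbf D=(D_1,\dots,D_m)$ (protected) and $\mathbf X=(X_1,\dots,X_n)$ (non-protected) real random vectors, $\mathbf Z=(\mathbf D,\mathbf X)$, $g:\mathbb R^{m+n}\to\mathbb R$ differentiable, $Y=g(\mathbf D,\mathbf X)\in L^2$. Assume that the conditional distribution function $F_{Y|\mathbf X}(\cdot|\mathbf x)$ is continuous for almost every $\mathbf x$, so that $U:=F_{Y|\mathbf X}(Y|\mathbf X)$ is uniform given $\mathbf X$. Let $\gamma:(0,1)\to\mathbb R$ be measurable and square-integrable. *Decision rules.* A weight is a function $\ell^{t,x}(u)=\zeta(x,u)+w(t,x)$ of $u\in(0,1)$, parametrized by the values $(t,x)$ of $(\mathbf D,\mathbf X)$, with $\zeta,w$ measurable and $\mathbb E\int_0^1\zeta(\mathbf X,u)^2du<\infty$, $\mathbb E[w(\mathbf D,\mathbf X)^2]<\infty$. Its decision rule is, for a random variable $R$, $$\rho_\ell(R|\mathbf X)=\int_0^1F^{-1}_{R|\mathbf X}(u|\mathbf X)\,\zeta(\mathbf X,u)\,du+\mathbb E[R\,w(\mathbf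 D,\mathbf X)|\mathbf X],$$ and $\ell(U)$ abbreviates $\ell^{\mathbf D,\mathbf X}(U)$. The weight $\gamma$ itself is the case $\zeta(x,u)=\gamma(u)$, $w=0$, in which $\rho_\gamma(R|\mathbf X)=\int_0^1F^{-1}_{R|\mathbf X}(u|\mathbf X)\gamma(u)du$. *Cascade perturbation.* For a protected index $i$, let $(\mathbf D,\mathbf X)=(\Psi_i^{(1)}(D_i,\mathbf V_i),\dots,\Psi_i^{(m+n)}(D_i,\mathbf V_i))$ a.s., where each coordinate of $\mathbf V_i$ is uniform on $(0,1)$ and independent of $D_i$, the $\Psi_i^{(k)}$ are measurable, $t\mapsto\Psi_i^{(k)}(t,\mathbf V_i)$ is a.s. differentiable on $\mathbb R$, and $\Psi_i^{(i)}(t,v)=t$. (The inverse Rosenblatt transform, where the coordinates are i.i.d. and jointly independent of $D_i$, is of this form.) Put $Y_{i,\delta}=g(\Psi_i^{(1)}(D_i(1+\delta),\mathbf V_i),\dots,\Psi_i^{(m+n)}(D_i(1+\delta),\mathbf V_i))$. The cascade sensitivity is $$\partial^c_{D_i}\rho_\ell(Y|\mathbf X)=\lim_{\delta\downarrow0}\frac{\rho_\ell(Y_{i,\delta}|\mathbf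 X)-\rho_\ell(Y|\mathbf X)}{\delta},$$ an almost sure limit along every sequence $\delta_j\downarrow 0$. The rule $\rho_\ell$ is marginally fair for $D_i$ with cascade sensitivity if this limit exists and is $0$ a.s., and multi-marginally fair if this holds for all $i\le m$. Write $$S_{i,k}=D_i\,\partial_kg(\mathbf D,\mathbf X)\,\tfrac{\partial}{\partial t}\Psi_i^{(k)}(t,\mathbf V_i)\big|_{t=D_i},\qquad \bar S_i=\mathbb E\Big[\sum_{k=1}^{m+n}S_{i,k}\,\Big|\,\mathbf D,\mathbf X\Big].$$ If $\Psi_i^{(k)}(t,\mathbf V_i)=F^{-1}_{k|D_i}(V_{i,k}|t)$ is the conditional quantile function of the $k$-th covariate given $D_i=t$ (for a fixed version of the conditional law), then the derivative in $S_{i,k}$ is $\frac{\partial}{\partial t}F^{-1}_{k|D_i}(V_{i,k}|t)|_{t=D_i}$. *Assumption for $i$.* $\mathrm{supp}(D_i)=\mathbb R$, and there are constants $c_1,c_2>0$ such that a.s., for all $t\in\mathbb R$ and all $k$, $\big(t\,\partial_kg(\Psi_i(t,\mathbf V_i))\,\frac{\partial}{\partial t}\Psi_i^{(k)}(t,\mathbf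 V_i)\big)^2<c_2$, and a.s. $\mathbb E[\bar S_i^2|\mathbf X]>c_1$. *Optimization problem.* Minimize $\mathbb E[(\gamma(U)-\ell(U))^2]$ over all weights $\ell$ for which $\rho_\ell$ is fair. **Proposition.** i) Let the assumption hold for $i$. The cascade sensitivity of $\rho_\gamma$ to $D_i$ exists and equals $$\partial^c_{D_i}\rho_\gamma(Y|\mathbf X)=\sum_{k=1}^{m+n}\mathbb E[S_{i,k}\,\gamma(U)|\mathbf X]\quad\text{a.s.}$$ The optimization problem under marginal fairness for $D_i$ with cascade sensitivity has a solution; a weight $\gamma^*$ is a solution if and only if $$\gamma^*(U)=\gamma(U)-\frac{\partial^c_{D_i}\rho_\gamma(Y|\mathbf X)}{\mathbb E[\bar S_i^2|\mathbf X]}\,\bar S_i\quad\text{a.s.},$$ and the resulting, unique, decision rule is a.s. $$\rho_{\gamma^*}(Y|\mathbf X)=\rho_\gamma(Y|\mathbf X)-\frac{\partial^c_{D_i}\rho_\gamma(Y|\mathbf X)}{\mathbb E[\bar S_i^2|\mathbf X]}\sum_{k=1}^{m+n}\mathbb E[Y\,S_{i,k}|\mathbf X].$$ ii) Let the assumption hold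 for all $i\in\{1,\dots,m\}$. The optimization problem under multi-marginal fairness with cascade sensitivity has a solution $\gamma^*$; $\gamma^*(U)$ and the decision rule $\rho_{\gamma^*}(Y|\mathbf X)$ are a.s. unique, and there are measurable $\eta_1,\dots,\eta_m:\mathbb R^n\to\mathbb R$ with, a.s., $$\gamma^*(U)=\gamma(U)-\sum_{l=1}^m\eta_l(\mathbf X)\bar S_l,\qquad \rho_{\gamma^*}(Y|\mathbf X)=\rho_\gamma(Y|\mathbf X)-\sum_{l=1}^m\eta_l(\mathbf X)\sum_{k=1}^{m+n}\mathbb E[Y\,S_{l,k}|\mathbf X].$$ Conversely, if measurable $\eta_1,\dots,\eta_m$ and a weight $\gamma^*$ are such that the first identity holds and $\rho_{\gamma^*}$ is multi-marginally fair with cascade sensitivity, then $\gamma^*$ is a solution and the second identity holds. In particular, if $\Psi_l^{(k)}(t,\mathbf V_l)=F^{-1}_{k|D_l}(V_{l,k}|t)$ for all $k$, then a.s., for all $k$, $\mathbb E[Y S_{l,k}|\mathbf X]=\mathbb E\big[Y\,D_l\,\partial_kg(\mathbf D,\mathbf X)\,\tfrac{\partial}{\partial t}F^{-1}_{k|D_l}(V_{l,k}|t)\big|_{t=D_l}\,\big|\,\mathbf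 X\big]$ and $\mathbb E[S_{l,k}\gamma(U)|\mathbf X]=\mathbb E\big[D_l\,\partial_kg(\mathbf D,\mathbf X)\,\tfrac{\partial}{\partial t}F^{-1}_{k|D_l}(V_{l,k}|t)\big|_{t=D_l}\gamma(U)\,\big|\,\mathbf X\big]$. -/

import Mathlib

open MeasureTheory ProbabilityTheory Filter Topology Set

noncomputable section

/-- The left-continuous quantile function `inf {y | u ≤ F y}` of a law on the line. -/
def quantile (ν : Measure ℝ) (u : ℝ) : ℝ := sInf {y : ℝ | u ≤ cdf ν y}

/-- The σ-algebra generated by the non-protected covariates `X`. -/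
abbrev sigmaX {Ω : Type*} {n : ℕ} (X : Ω → Fin n → ℝ) : MeasurableSpace Ω :=
  MeasurableSpace.comap X inferInstance

/-- The σ-algebra generated by all covariates `(D, X)`. -/
abbrev sigmaDX {Ω : Type*} {m n : ℕ} (D : Ω → Fin m → ℝ) (X : Ω → Fin n → ℝ) :
    MeasurableSpace Ω :=
  MeasurableSpace.comap (fun ω => (D ω, X ω)) inferInstance

/-- The vector of all covariates; `Sum.inl` indexes the protected ones, `Sum.inr` the others. -/
def covariates {Ω : Type*} {m n : ℕ} (D : Ω → Fin m → ℝ) (X : Ω → Fin n → ℝ) (ω : Ω) :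
    Fin m ⊕ Fin n → ℝ :=
  Sum.elim (D ω) (X ω)

/-- The response `Y = g (D, X)`. -/
def response {Ω : Type*} {m n : ℕ} (D : Ω → Fin m → ℝ) (X : Ω → Fin n → ℝ)
    (g : (Fin m ⊕ Fin n → ℝ) → ℝ) (ω : Ω) : ℝ :=
  g (covariates D X ω)

/-- The conditional rank `U_{Y|X} = F_{Y|X}(Y | X)`. -/
def condRank {Ω : Type*} [MeasurableSpace Ω] (μ : Measure Ω) [IsFiniteMeasure μ] {n : ℕ}
    (X : Ω → Fin n → ℝ) (Y : Ω → ℝ) (ω : Ω) : ℝ :=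
  cdf (condDistrib Y X μ (X ω)) (Y ω)

/-- The partial derivative of `g` in its `k`-th argument. -/
def partialDeriv {m n : ℕ} (g : (Fin m ⊕ Fin n → ℝ) → ℝ) (k : Fin m ⊕ Fin n)
    (z : Fin m ⊕ Fin n → ℝ) : ℝ :=
  fderiv ℝ g z (Pi.single k 1)

/-- A weight function parametrized by the values `(t, x)` of `(D, X)`:
`ℓ^{t,x}(u) = rank x u + state t x`. The part `rank x u` weights the conditional quantile of
level `u` of whatever variable the rule is applied to; the part `state t x` weights the outcome by
the covariates. Every square-integrable function of `(D, X)` is of the form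
`ℓ^{D,X}(U_{Y|X})` for such a weight. -/
structure Weight (m n : ℕ) where
  rank : (Fin n → ℝ) → ℝ → ℝ
  state : (Fin m → ℝ) → (Fin n → ℝ) → ℝ

/-- An ordinary weight function `γ : (0,1) → ℝ`, the same for all `(t, x)`. -/
def Weight.const {m n : ℕ} (γ : ℝ → ℝ) : Weight m n := ⟨fun _ u => γ u, fun _ _ => 0⟩

/-- Measurability and square-integrability of a parametrized weight function. -/
structure Weight.Admissible {Ω : Type*} [MeasurableSpace Ω] (μ : Measure Ω) {m n : ℕ}
    (D : Ω → Fin m → ℝ) (X : Ω → Fin n → ℝ) (ℓ : Weight m n) : Prop where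
  measurable_rank : Measurable (Function.uncurry ℓ.rank)
  measurable_state : Measurable (Function.uncurry ℓ.state)
  memLp_rank : MemLp (Function.uncurry ℓ.rank) 2 ((μ.map X).prod (volume.restrict (Ioo 0 1)))
  memLp_state : MemLp (fun ω => ℓ.state (D ω) (X ω)) 2 μ

/-- The random weight `ℓ^{D,X}(U_{Y|X})`. -/
def Weight.realized {Ω : Type*} [MeasurableSpace Ω] (μ : Measure Ω) [IsFiniteMeasure μ] {m n : ℕ}
    (D : Ω → Fin m → ℝ) (X : Ω → Fin n → ℝ) (Y : Ω → ℝ) (ℓ : Weight m n) (ω : Ω) : ℝ :=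
  ℓ.rank (X ω) (condRank μ X Y ω) + ℓ.state (D ω) (X ω)

/-- The decision rule `ρ_ℓ(Z | X)` applied to a random variable `Z`. For `ℓ = Weight.const γ` it is
the conditional generalized distortion risk measure `∫₀¹ F⁻¹_{Z|X}(u | X) γ(u) du`. -/
def decisionRule {Ω : Type*} [MeasurableSpace Ω] (μ : Measure Ω) [IsFiniteMeasure μ] {m n : ℕ}
    (D : Ω → Fin m → ℝ) (X : Ω → Fin n → ℝ) (ℓ : Weight m n) (Z : Ω → ℝ) (ω : Ω) : ℝ :=
  (∫ u in Ioo (0 : ℝ) 1, quantile (condDistrib Z X μ (X ω)) u * ℓ.rank (X ω) u)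
    + (μ[fun ω' => Z ω' * ℓ.state (D ω') (X ω') | sigmaX X]) ω

/-- `(D, X) = Ψ(D_i, V)` almost surely, where every coordinate of `V` is uniform on `(0,1)` and
independent of `D_i`, and `Ψ` is differentiable in its first argument. An inverse Rosenblatt
transform (with i.i.d. uniform coordinates, jointly independent of `D_i`) is of this form, and so
is the representation of each covariate through its own conditional quantile function given `D_i`.
The coordinate of `V` with the index of `D_i` itself plays no role. -/
structure IsCascadeRep {Ω : Type*} [MeasurableSpace Ω] (μ : Measure Ω) {m n : ℕ}
    (D : Ω → Fin m → ℝ) (X : Ω → Fin n → ℝ) (i : Fin m) (V : Ω → Fin m ⊕ Fin n → ℝ)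
    (Ψ : Fin m ⊕ Fin n → ℝ → (Fin m ⊕ Fin n → ℝ) → ℝ) : Prop where
  measurable_V : Measurable V
  uniform : ∀ k, μ.map (fun ω => V ω k) = volume.restrict (Ioo 0 1)
  indep : ∀ k, IndepFun (fun ω => V ω k) (fun ω => D ω i) μ
  measurable_Psi : ∀ k, Measurable (Function.uncurry (Ψ k))
  self : ∀ t v, Ψ (Sum.inl i) t v = t
  repr : ∀ᵐ ω ∂μ, ∀ k, Ψ k (D ω i) (V ω) = covariates D X ω k
  differentiable : ∀ᵐ ω ∂μ, ∀ k, Differentiable ℝ (fun t => Ψ k t (V ω))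

/-- The response under the cascade perturbation: `g (Ψ(D_i (1 + δ), V))`. -/
def perturbed {Ω : Type*} {m n : ℕ} (D : Ω → Fin m → ℝ) (g : (Fin m ⊕ Fin n → ℝ) → ℝ)
    (i : Fin m) (V : Ω → Fin m ⊕ Fin n → ℝ)
    (Ψ : Fin m ⊕ Fin n → ℝ → (Fin m ⊕ Fin n → ℝ) → ℝ) (δ : ℝ) (ω : Ω) : ℝ :=
  g (fun k => Ψ k (D ω i * (1 + δ)) (V ω))

/-- `L` is the cascade sensitivity `∂ᶜ_{D_i} ρ_ℓ(Y | X)`, the almost sure limit of the difference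
quotients as `δ ↓ 0`. The conditional quantities are defined up to null sets that depend on `δ`,
so the limit is taken along arbitrary sequences. -/
def HasCascadeSensitivity {Ω : Type*} [MeasurableSpace Ω] (μ : Measure Ω) [IsFiniteMeasure μ]
    {m n : ℕ} (D : Ω → Fin m → ℝ) (X : Ω → Fin n → ℝ) (g : (Fin m ⊕ Fin n → ℝ) → ℝ)
    (i : Fin m) (V : Ω → Fin m ⊕ Fin n → ℝ)
    (Ψ : Fin m ⊕ Fin n → ℝ → (Fin m ⊕ Fin n → ℝ) → ℝ) (ℓ : Weight m n) (L : Ω → ℝ) : Prop :=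
  ∀ δ : ℕ → ℝ, (∀ j, 0 < δ j) → Tendsto δ atTop (𝓝 0) →
    ∀ᵐ ω ∂μ, Tendsto
      (fun j => (decisionRule μ D X ℓ (perturbed D g i V Ψ (δ j)) ω
        - decisionRule μ D X ℓ (response D X g) ω) / δ j) atTop (𝓝 (L ω))

/-- The rule is marginally fair for `D_i` with cascade sensitivity. -/
def IsCascadeFair {Ω : Type*} [MeasurableSpace Ω] (μ : Measure Ω) [IsFiniteMeasure μ]
    {m n : ℕ} (D : Ω → Fin m → ℝ) (X : Ω → Fin n → ℝ) (g : (Fin m ⊕ Fin n → ℝ) → ℝ)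
    (i : Fin m) (V : Ω → Fin m ⊕ Fin n → ℝ)
    (Ψ : Fin m ⊕ Fin n → ℝ → (Fin m ⊕ Fin n → ℝ) → ℝ) (ℓ : Weight m n) : Prop :=
  HasCascadeSensitivity μ D X g i V Ψ ℓ (fun _ => 0)

/-- The `k`-th cascade term `D_i ∂_k g(D, X) ∂_t Ψ^{(k)}(t, V)|_{t = D_i}`. -/
def cascadeTerm {Ω : Type*} {m n : ℕ} (D : Ω → Fin m → ℝ) (X : Ω → Fin n → ℝ)
    (g : (Fin m ⊕ Fin n → ℝ) → ℝ) (i : Fin m) (V : Ω → Fin m ⊕ Fin n → ℝ)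
    (Ψ : Fin m ⊕ Fin n → ℝ → (Fin m ⊕ Fin n → ℝ) → ℝ) (k : Fin m ⊕ Fin n) (ω : Ω) : ℝ :=
  D ω i * partialDeriv g k (covariates D X ω) * deriv (fun t => Ψ k t (V ω)) (D ω i)

/-- The direction of the adjustment: the conditional expectation given `(D, X)` of the sum of the
cascade terms (the sum itself, if `V` is a function of `(D, X)`). -/
def cascadeDirection {Ω : Type*} [MeasurableSpace Ω] (μ : Measure Ω) {m n : ℕ}
    (D : Ω → Fin m → ℝ) (X : Ω → Fin n → ℝ)
    (g : (Fin m ⊕ Fin n → ℝ) → ℝ) (i : Fin m) (V : Ω → Fin m ⊕ Fin n → ℝ)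
    (Ψ : Fin m ⊕ Fin n → ℝ → (Fin m ⊕ Fin n → ℝ) → ℝ) : Ω → ℝ :=
  μ[fun ω => ∑ k, cascadeTerm D X g i V Ψ k ω | sigmaDX D X]

/-- The integrability assumption for the cascade perturbation of `D_i`. -/
def CascadeIntegrability {Ω : Type*} [MeasurableSpace Ω] (μ : Measure Ω) {m n : ℕ}
    (D : Ω → Fin m → ℝ) (X : Ω → Fin n → ℝ)
    (g : (Fin m ⊕ Fin n → ℝ) → ℝ) (i : Fin m) (V : Ω → Fin m ⊕ Fin n → ℝ)
    (Ψ : Fin m ⊕ Fin n → ℝ → (Fin m ⊕ Fin n → ℝ) → ℝ) : Prop :=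
  ∃ c₁ c₂ : ℝ, 0 < c₁ ∧ 0 < c₂ ∧
    (∀ᵐ ω ∂μ, ∀ (t : ℝ) (k : Fin m ⊕ Fin n),
      (t * partialDeriv g k (fun j => Ψ j t (V ω)) * deriv (fun s => Ψ k s (V ω)) t) ^ 2 < c₂) ∧
    ∀ᵐ ω ∂μ, c₁ < (μ[fun ω' => (cascadeDirection μ D X g i V Ψ ω') ^ 2 | sigmaX X]) ω

/-- The objective: the expected squared distance between the weights `γ` and `ℓ` at the
conditionally uniform level `U_{Y|X}`. -/
def weightCost {Ω : Type*} [MeasurableSpace Ω] (μ : Measure Ω) [IsFiniteMeasure μ] {m n : ℕ}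
    (D : Ω → Fin m → ℝ) (X : Ω → Fin n → ℝ) (Y : Ω → ℝ) (γ : ℝ → ℝ) (ℓ : Weight m n) : ℝ :=
  ∫ ω, (γ (condRank μ X Y ω) - ℓ.realized μ D X Y ω) ^ 2 ∂μ

/-- `ℓ` is as close as possible to `γ` among the admissible weights that satisfy `Fair`. -/
def IsOptimalWeight {Ω : Type*} [MeasurableSpace Ω] (μ : Measure Ω) [IsFiniteMeasure μ] {m n : ℕ}
    (D : Ω → Fin m → ℝ) (X : Ω → Fin n → ℝ) (Y : Ω → ℝ) (γ : ℝ → ℝ)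
    (Fair : Weight m n → Prop) (ℓ : Weight m n) : Prop :=
  ℓ.Admissible μ D X ∧ Fair ℓ ∧
    ∀ ℓ' : Weight m n, ℓ'.Admissible μ D X → Fair ℓ' →
      weightCost μ D X Y γ ℓ ≤ weightCost μ D X Y γ ℓ'

/-- The Markov kernels `κ k` are versions of the conditional laws of the `k`-th covariate given
`D_i`, and the `k`-th component of the representation is the conditional quantile function
`F⁻¹_{k|D_i}(V_k | t)` of that version. -/
def IsQuantileRep {Ω : Type*} [MeasurableSpace Ω] (μ : Measure Ω) {m n : ℕ}
    (D : Ω → Fin m → ℝ) (X : Ω → Fin n → ℝ) (i : Fin m) (V : Ω → Fin m ⊕ Fin n → ℝ)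
    (Ψ : Fin m ⊕ Fin n → ℝ → (Fin m ⊕ Fin n → ℝ) → ℝ)
    (κ : Fin m ⊕ Fin n → Kernel ℝ ℝ) : Prop :=
  ∀ k, IsMarkovKernel (κ k) ∧
    (μ.map (fun ω => D ω i)) ⊗ₘ (κ k) = μ.map (fun ω => (D ω i, covariates D X ω k)) ∧
    ∀ᵐ ω ∂μ, ∀ t, Ψ k t (V ω) = quantile (κ k t) (V ω k)

/-- The `k`-th cascade term written with conditional quantile functions,
`D_i ∂_k g(D, X) ∂_t F⁻¹_{k|D_i}(V_k | t)|_{t = D_i}`. -/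
def quantileTerm {Ω : Type*} {m n : ℕ} (D : Ω → Fin m → ℝ) (X : Ω → Fin n → ℝ)
    (g : (Fin m ⊕ Fin n → ℝ) → ℝ) (i : Fin m) (V : Ω → Fin m ⊕ Fin n → ℝ)
    (κ : Fin m ⊕ Fin n → Kernel ℝ ℝ) (k : Fin m ⊕ Fin n) (ω : Ω) : ℝ :=
  D ω i * partialDeriv g k (covariates D X ω) * deriv (fun t => quantile (κ k t) (V ω k)) (D ω i)

end

/-!
A decision rule is a conditional expectation in disguise: since `F_{Y|X}` is continuous, the rank
`U` is uniform and independent of `X`, and `ρ_ℓ(Y | X) = 𝔼[Y ℓ(U) | X]`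
(`decisionRule_ae_eq_condExp`). The same is true of its derivative along a perturbation `Y_δ` with
`|Y_δ - Y| ≤ C δ` and `(Y_δ - Y) / δ → S`: the derivative is `𝔼[S ℓ(U) | X]`
(`tendsto_decisionRule_difference_quotient`). To see this, condition everything on `X = x`, which
leaves a statement about the quantile functions of real random variables
(`tendsto_integral_quantile_difference_quotient`). There the difference quotients of the quantile
functions are bounded by `C`, so by density (`tendsto_integral_mul_of_tendsto_setIntegral_Ioi`) it
is enough to test against the indicators of half-lines. For these, the tail integral
`∫ₐ¹ F_Z⁻¹` is at least `𝔼[Z 1_A]` for every event `A` of probability `1 - a` and at most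
`(1 - a) c + 𝔼 (Z - c)⁺` for every `c`, with equality for `Z = Y`, `c = F_Y⁻¹(a)`, `A = {Y > c}`;
dominated convergence in both bounds gives the same limit.

For the cascade perturbation, the bound on the cascade terms along the whole path gives
`|Y_δ - Y| ≤ C δ` by the mean value inequality, and the chain rule identifies `S` as the sum of the
cascade terms. As `ℓ(U)` is a function of `(D, X)`, the sum may be replaced by its conditional
expectation `S̄` given `(D, X)`, so that a rule is fair exactly if `𝔼[S̄ ℓ(U) | X] = 0`
(`isCascadeFair_iff`). Conversely every square-integrable function of `(D, X)` is `ℓ(U)` for some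
weight. The optimization problem is therefore the orthogonal projection of `γ(U)` onto the
variables that are conditionally orthogonal to the `S̄_i`, and the solution is `γ(U)` minus a
combination of the `S̄_i` with coefficients that depend on `X`. The coefficients come from a
conditional Gram–Schmidt procedure (`exists_condExp_mul_sub_sum_eq_zero`), which needs no linear
independence of the `S̄_i`; optimality and uniqueness are Pythagoras (`integral_sq_sub_eq_add`,
`exists_isOptimalWeight_and_iff`).
-/

/-! ### Quantile functions and the uniform law -/

/-- The uniform law on the open unit interval. -/
noncomputable abbrev unif : Measure ℝ := volume.restrict (Ioo (0 : ℝ) 1)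

instance isProbabilityMeasure_unif : IsProbabilityMeasure unif :=
  ⟨by simp [unif]⟩

theorem ae_unif_mem_Ioo : ∀ᵐ u ∂unif, u ∈ Ioo (0 : ℝ) 1 := ae_restrict_mem measurableSet_Ioo

section Quantile

variable (ν : Measure ℝ)

theorem quantile_set_nonempty {u : ℝ} (hu : u < 1) : {y : ℝ | u ≤ cdf ν y}.Nonempty := by
  obtain ⟨y, hy⟩ := ((tendsto_cdf_atTop ν).eventually (lt_mem_nhds hu)).exists
  exact ⟨y, hy.le⟩

theorem quantile_set_bddBelow {u : ℝ} (hu : 0 < u) : BddBelow {y : ℝ | u ≤ cdf ν y} := by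
  obtain ⟨y, hy⟩ := ((tendsto_cdf_atBot ν).eventually (gt_mem_nhds hu)).exists
  refine ⟨y, fun z hz => ?_⟩
  by_contra! h
  exact absurd (lt_of_le_of_lt (hz.trans (monotone_cdf ν h.le)) hy) (lt_irrefl _)

theorem le_cdf_quantile {u : ℝ} (hu : u ∈ Ioo (0 : ℝ) 1) : u ≤ cdf ν (quantile ν u) := by
  have hc : Tendsto (cdf ν) (𝓝[>] (quantile ν u)) (𝓝 (cdf ν (quantile ν u))) :=
    ((cdf ν).right_continuous _).mono_left (nhdsWithin_mono _ Ioi_subset_Ici_self)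
  refine ge_of_tendsto hc ?_
  filter_upwards [self_mem_nhdsWithin] with z hz
  obtain ⟨y, hy, hyz⟩ := (csInf_lt_iff (quantile_set_bddBelow ν hu.1)
    (quantile_set_nonempty ν hu.2)).1 hz
  exact le_trans hy (monotone_cdf ν hyz.le)

/-- The Galois connection between the quantile function and the distribution function. -/
theorem quantile_le_iff {u : ℝ} (hu : u ∈ Ioo (0 : ℝ) 1) (y : ℝ) :
    quantile ν u ≤ y ↔ u ≤ cdf ν y :=
  ⟨fun h => (le_cdf_quantile ν hu).trans (monotone_cdf ν h),
    fun h => csInf_le (quantile_set_bddBelow ν hu.1) h⟩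

theorem monotoneOn_quantile : MonotoneOn (quantile ν) (Ioo 0 1) := fun _ hu _ hv huv =>
  (quantile_le_iff ν hu _).2 (huv.trans (le_cdf_quantile ν hv))

theorem aemeasurable_quantile : AEMeasurable (quantile ν) unif :=
  aemeasurable_restrict_of_monotoneOn measurableSet_Ioo (monotoneOn_quantile ν)

/-- Quantile transform: `F⁻¹` of a uniform variable has the law with distribution function `F`. -/
theorem map_quantile_unif [IsProbabilityMeasure ν] : unif.map (quantile ν) = ν := by
  have := Measure.isProbabilityMeasure_map (aemeasurable_quantile ν)
  refine Measure.ext_of_Iic _ _ fun y => ?_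
  rw [Measure.map_apply_of_aemeasurable (aemeasurable_quantile ν) measurableSet_Iic,
    Measure.restrict_apply' measurableSet_Ioo, ← ofReal_cdf]
  have h : quantile ν ⁻¹' Iic y ∩ Ioo 0 1 = Iic (cdf ν y) ∩ Ioo 0 1 := by
    ext u
    simp only [mem_inter_iff, mem_preimage, mem_Iic, and_congr_left_iff]
    exact fun hu => quantile_le_iff ν hu y
  rw [h]
  have h0 := cdf_nonneg ν y
  have h1 := cdf_le_one ν y
  apply le_antisymm
  · refine (measure_mono (t := Ioc 0 (cdf ν y)) fun u hu => ⟨hu.2.1, hu.1⟩).trans ?_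
    simp
  · refine le_trans ?_ (measure_mono (s := Ioo 0 (cdf ν y)) fun u hu =>
      ⟨hu.2.le, hu.1, hu.2.trans_le h1⟩)
    simp

theorem cdf_quantile [IsProbabilityMeasure ν] [NullSingletonClass ν] {u : ℝ}
    (hu : u ∈ Ioo (0 : ℝ) 1) : cdf ν (quantile ν u) = u := by
  refine le_antisymm ?_ (le_cdf_quantile ν hu)
  have h : (cdf ν).measure {quantile ν u} = 0 := by rw [measure_cdf]; exact measure_singleton _
  rw [StieltjesFunction.measure_singleton, ENNReal.ofReal_eq_zero, sub_nonpos] at h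
  refine h.trans (le_of_tendsto ((monotone_cdf ν).tendsto_leftLim _) ?_)
  filter_upwards [self_mem_nhdsWithin] with z hz
  by_contra! hz'
  exact absurd ((quantile_le_iff ν hu z).2 hz'.le) (not_le.2 hz)

/-- Probability integral transform: `F` of a variable with continuous distribution function `F`
is uniform. -/
theorem map_cdf_eq_unif [IsProbabilityMeasure ν] [NullSingletonClass ν] :
    ν.map (cdf ν) = unif := by
  have hm : Measurable (cdf ν) := (monotone_cdf ν).measurable
  have h : ν.map (cdf ν) = (unif.map (quantile ν)).map (cdf ν) := by rw [map_quantile_unif]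
  rw [h, AEMeasurable.map_map_of_aemeasurable hm.aemeasurable (aemeasurable_quantile ν)]
  conv_rhs => rw [← Measure.map_id (μ := unif)]
  refine Measure.map_congr ?_
  filter_upwards [ae_unif_mem_Ioo] with u hu using cdf_quantile ν hu

end Quantile

section QuantileMap

variable {E : Type*} [MeasurableSpace E] {P : Measure E} [IsProbabilityMeasure P]

theorem cdf_map_le_of_le_add {Y Z : E → ℝ} (hY : AEMeasurable Y P) (hZ : AEMeasurable Z P) {c : ℝ}
    (h : ∀ᵐ e ∂P, Z e ≤ Y e + c) (y : ℝ) : cdf (P.map Y) y ≤ cdf (P.map Z) (y + c) := by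
  have := Measure.isProbabilityMeasure_map hY
  have := Measure.isProbabilityMeasure_map hZ
  rw [cdf_eq_real, cdf_eq_real, measureReal_def, measureReal_def,
    Measure.map_apply_of_aemeasurable hY measurableSet_Iic,
    Measure.map_apply_of_aemeasurable hZ measurableSet_Iic]
  refine ENNReal.toReal_mono (measure_ne_top _ _) (measure_mono_ae ?_)
  filter_upwards [h] with e he hye
  have : Y e ≤ y := hye
  change Z e ≤ y + c
  linarith

/-- Quantile functions are `1`-Lipschitz with respect to the uniform norm of random variables. -/
theorem abs_quantile_sub_le {Y Z : E → ℝ} (hY : AEMeasurable Y P) (hZ : AEMeasurable Z P) {c : ℝ}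
    (h : ∀ᵐ e ∂P, |Z e - Y e| ≤ c) {u : ℝ} (hu : u ∈ Ioo (0 : ℝ) 1) :
    |quantile (P.map Z) u - quantile (P.map Y) u| ≤ c := by
  have h1 : quantile (P.map Z) u ≤ quantile (P.map Y) u + c :=
    (quantile_le_iff _ hu _).2 <| (le_cdf_quantile _ hu).trans <|
      cdf_map_le_of_le_add hY hZ (h.mono fun e he => by linarith [abs_le.1 he]) _
  have h2 : quantile (P.map Y) u ≤ quantile (P.map Z) u + c :=
    (quantile_le_iff _ hu _).2 <| (le_cdf_quantile _ hu).trans <|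
      cdf_map_le_of_le_add hZ hY (h.mono fun e he => by linarith [abs_le.1 he]) _
  exact abs_le.2 ⟨by linarith, by linarith⟩

end QuantileMap

/-! ### Weak convergence against half-lines -/

section WeakLimit

variable {E : Type*} [MeasurableSpace E] {P : Measure E} [IsProbabilityMeasure P]
  {lam : Measure ℝ} [IsProbabilityMeasure lam]

theorem integrable_of_ae_bound {α : Type*} [MeasurableSpace α] {m : Measure α} [IsFiniteMeasure m]
    {f : α → ℝ} {C : ℝ} (hf : AEStronglyMeasurable f m) (h : ∀ᵐ x ∂m, |f x| ≤ C) : Integrable f m :=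
  Integrable.of_bound hf C (by simpa using h)

theorem abs_setIntegral_le_of_ae_bound {α : Type*} [MeasurableSpace α] {m : Measure α}
    [IsFiniteMeasure m] {f : α → ℝ} {C : ℝ} (h : ∀ᵐ x ∂m, |f x| ≤ C) (s : Set α) :
    |∫ x in s, f x ∂m| ≤ C * m.real s := by
  have := norm_setIntegral_le_of_norm_le_const_ae' (μ := m) (f := f) (C := C) (s := s)
    (measure_lt_top _ _) (h.mono fun x hx _ => by simpa using hx)
  simpa using this

/-- Bounded functions `f j` on the line whose integrals over all half-lines `(a, ∞)` converge to
the integrals of `S` over `{U > a}` converge weakly to `S`, seen through `U`: the convergence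
extends to all measurable sets by a monotone class argument, and then to integrable test functions
by density. -/
theorem tendsto_integral_mul_of_tendsto_setIntegral_Ioi {U S : E → ℝ} (hU : Measurable U)
    (hmap : P.map U = lam) {f : ℕ → ℝ → ℝ} {C : ℝ}
    (hf : ∀ j, AEStronglyMeasurable (f j) lam) (hfC : ∀ j, ∀ᵐ u ∂lam, |f j u| ≤ C)
    (hS : AEStronglyMeasurable S P) (hSC : ∀ᵐ e ∂P, |S e| ≤ C)
    (hlim : ∀ a : ℝ, Tendsto (fun j => ∫ u in Ioi a, f j u ∂lam) atTop
      (𝓝 (∫ e in U ⁻¹' Ioi a, S e ∂P)))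
    (huniv : Tendsto (fun j => ∫ u, f j u ∂lam) atTop (𝓝 (∫ e, S e ∂P)))
    {ζ : ℝ → ℝ} (hζ : Integrable ζ lam) :
    Tendsto (fun j => ∫ u, f j u * ζ u ∂lam) atTop (𝓝 (∫ e, S e * ζ (U e) ∂P)) := by
  have hfi := fun j => integrable_of_ae_bound (hf j) (hfC j)
  have hSi := integrable_of_ae_bound hS hSC
  -- convergence on measurable sets
  have hset : ∀ t : Set ℝ, MeasurableSet t → Tendsto (fun j => ∫ u in t, f j u ∂lam) atTop
      (𝓝 (∫ e in U ⁻¹' t, S e ∂P)) := by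
    refine MeasurableSpace.induction_on_inter
      (borel_eq_generateFrom_Ioi ℝ ▸ BorelSpace.measurable_eq) isPiSystem_Ioi ?_ ?_ ?_ ?_
    · simp
    · rintro _ ⟨a, rfl⟩
      exact hlim a
    · intro t ht ih
      have h1 : ∀ j, ∫ u in tᶜ, f j u ∂lam = (∫ u, f j u ∂lam) - ∫ u in t, f j u ∂lam :=
        fun j => setIntegral_compl ht (hfi j)
      have h2 : ∫ e in U ⁻¹' tᶜ, S e ∂P = (∫ e, S e ∂P) - ∫ e in U ⁻¹' t, S e ∂P :=
        setIntegral_compl (hU ht) hSi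
      simp_rw [h1, h2]
      exact huniv.sub ih
    · intro t hd ht ih
      have h1 : ∀ j, ∫ u in ⋃ i, t i, f j u ∂lam = ∑' i, ∫ u in t i, f j u ∂lam :=
        fun j => integral_iUnion ht hd (hfi j).integrableOn
      have h2 : ∫ e in U ⁻¹' (⋃ i, t i), S e ∂P = ∑' i, ∫ e in U ⁻¹' t i, S e ∂P := by
        rw [preimage_iUnion]
        exact integral_iUnion (fun i => hU (ht i))
          (fun i j hij => (hd hij).preimage U) hSi.integrableOn
      simp_rw [h1, h2]
      refine tendsto_tsum_of_dominated_convergence (bound := fun i => C * lam.real (t i))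
        ?_ ih (Eventually.of_forall fun j i => ?_)
      · refine Summable.mul_left _ (ENNReal.summable_toReal ?_)
        rw [← measure_iUnion hd ht]
        exact measure_ne_top _ _
      · exact abs_setIntegral_le_of_ae_bound (hfC j) _
  have hC : 0 ≤ C := by
    obtain ⟨e, he⟩ := hSC.exists
    exact (abs_nonneg _).trans he
  have hUmp : MeasurePreserving U P lam := ⟨hU, hmap⟩
  have hcomp : ∀ {h : ℝ → ℝ}, Integrable h lam → Integrable (fun e => h (U e)) P := fun {h} hh =>
    hUmp.integrable_comp_of_integrable hh
  have hint : ∀ {h : ℝ → ℝ}, Integrable h lam → ∫ u, h u ∂lam = ∫ e, h (U e) ∂P := fun {h} hh => by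
    rw [← hmap, integral_map hU.aemeasurable (hmap.symm ▸ hh.1)]
  have hfm : ∀ j {h : ℝ → ℝ}, Integrable h lam → Integrable (fun u => f j u * h u) lam :=
    fun j h hh => hh.bdd_mul (hf j) (c := C) (by simpa using hfC j)
  have hSm : ∀ {h : ℝ → ℝ}, Integrable h lam → Integrable (fun e => S e * h (U e)) P :=
    fun {h} hh => (hcomp hh).bdd_mul hS (c := C) (by simpa using hSC)
  refine Integrable.induction (fun ζ : ℝ → ℝ => Tendsto (fun j => ∫ u, f j u * ζ u ∂lam) atTop
    (𝓝 (∫ e, S e * ζ (U e) ∂P))) ?_ ?_ ?_ ?_ hζ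
  · intro c t ht _
    have h1 : ∀ j, ∫ u, f j u * t.indicator (fun _ => c) u ∂lam = (∫ u in t, f j u ∂lam) * c := by
      intro j
      rw [← integral_mul_const, ← integral_indicator ht]
      congr with u
      by_cases hu : u ∈ t <;> simp [hu]
    have h2 : ∫ e, S e * t.indicator (fun _ => c) (U e) ∂P = (∫ e in U ⁻¹' t, S e ∂P) * c := by
      rw [← integral_mul_const, ← integral_indicator (hU ht)]
      congr with e
      by_cases hu : U e ∈ t <;> simp [hu]
    simp_rw [h1, h2]
    exact (hset t ht).mul_const c
  · intro h k _ hh hk ih ik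
    have h1 : ∀ j, ∫ u, f j u * (h + k) u ∂lam
        = ∫ u, f j u * h u ∂lam + ∫ u, f j u * k u ∂lam := by
      intro j
      rw [← integral_add (hfm j hh) (hfm j hk)]
      simp [mul_add]
    have h2 : ∫ e, S e * (h + k) (U e) ∂P
        = ∫ e, S e * h (U e) ∂P + ∫ e, S e * k (U e) ∂P := by
      rw [← integral_add (hSm hh) (hSm hk)]
      simp [mul_add]
    simp_rw [h1, h2]
    exact ih.add ik
  · -- the property is stable under `L¹` limits, uniformly in `j`
    refine isClosed_of_closure_subset fun h hh => ?_
    rw [mem_ofPred_eq, Metric.tendsto_atTop]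
    intro ε hε
    obtain ⟨k, hk, hkε⟩ := Metric.mem_closure_iff.1 hh (ε / (3 * (C + 1))) (by positivity)
    rw [mem_ofPred_eq, Metric.tendsto_atTop] at hk
    obtain ⟨N, hN⟩ := hk (ε / 3) (by positivity)
    have hhi := L1.integrable_coeFn h
    have hki := L1.integrable_coeFn k
    have hdi : Integrable (fun u => C * |h u - k u|) lam := (hhi.sub hki).abs.const_mul C
    have hd : ∫ u, |h u - k u| ∂lam < ε / (3 * (C + 1)) := by
      rw [dist_eq_norm, L1.norm_eq_integral_norm] at hkε
      convert hkε using 1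
      refine integral_congr_ae ?_
      filter_upwards [Lp.coeFn_sub h k] with u hu
      rw [hu]
      rfl
    have hd' : C * ∫ u, |h u - k u| ∂lam < ε / 3 := by
      have h0 : 0 ≤ ∫ u, |h u - k u| ∂lam := integral_nonneg fun _ => abs_nonneg _
      calc C * ∫ u, |h u - k u| ∂lam ≤ (C + 1) * ∫ u, |h u - k u| ∂lam := by
            gcongr; linarith
        _ < (C + 1) * (ε / (3 * (C + 1))) := by gcongr
        _ = ε / 3 := by field_simp
    have h1 : ∀ j, |(∫ u, f j u * h u ∂lam) - ∫ u, f j u * k u ∂lam| < ε / 3 := by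
      intro j
      refine lt_of_le_of_lt ?_ hd'
      rw [← Real.norm_eq_abs, ← integral_sub (hfm j hhi) (hfm j hki), ← integral_const_mul]
      refine norm_integral_le_of_norm_le hdi ?_
      filter_upwards [hfC j] with u hu
      rw [← mul_sub, norm_mul]
      exact mul_le_mul_of_nonneg_right hu (norm_nonneg _)
    have h2 : |(∫ e, S e * h (U e) ∂P) - ∫ e, S e * k (U e) ∂P| < ε / 3 := by
      refine lt_of_le_of_lt ?_ hd'
      rw [← Real.norm_eq_abs, ← integral_sub (hSm hhi) (hSm hki), ← integral_const_mul]
      rw [hint hdi]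
      refine norm_integral_le_of_norm_le (hcomp hdi) ?_
      filter_upwards [hSC] with u hu
      rw [← mul_sub, norm_mul]
      exact mul_le_mul_of_nonneg_right hu (norm_nonneg _)
    refine ⟨N, fun j hj => ?_⟩
    have h4 := hN j hj
    have h5 := h1 j
    rw [Real.dist_eq] at *
    rw [abs_lt] at *
    constructor <;> linarith
  · intro h k hhk hh ih
    have h1 : ∀ j, ∫ u, f j u * k u ∂lam = ∫ u, f j u * h u ∂lam := fun j =>
      integral_congr_ae (hhk.mono fun u hu => by simp only [hu])
    have h2 : ∫ e, S e * k (U e) ∂P = ∫ e, S e * h (U e) ∂P :=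
      integral_congr_ae ((hUmp.quasiMeasurePreserving.ae hhk).mono fun u hu => by simp only [hu])
    simp_rw [h1, h2]
    exact ih

end WeakLimit

/-! ### Directional derivatives of distortion risk measures -/

section QuantileDerivative

variable {E : Type*} [MeasurableSpace E] {P : Measure E} [IsProbabilityMeasure P]

theorem integrable_quantile_map {Z : E → ℝ} (hZm : AEMeasurable Z P) (hZ : Integrable Z P) :
    Integrable (quantile (P.map Z)) unif := by
  have := Measure.isProbabilityMeasure_map hZm
  have h : Integrable (fun y : ℝ => y) (unif.map (quantile (P.map Z))) := by
    rw [map_quantile_unif]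
    exact (integrable_map_measure aestronglyMeasurable_id hZm).2 hZ
  exact (integrable_map_measure aestronglyMeasurable_id (aemeasurable_quantile _)).1 h

theorem integral_comp_quantile_map {Z : E → ℝ} (hZm : AEMeasurable Z P) {φ : ℝ → ℝ}
    (hφ : Measurable φ) : ∫ u, φ (quantile (P.map Z) u) ∂unif = ∫ e, φ (Z e) ∂P := by
  have := Measure.isProbabilityMeasure_map hZm
  rw [← integral_map (aemeasurable_quantile _) hφ.aestronglyMeasurable, map_quantile_unif,
    integral_map hZm hφ.aestronglyMeasurable]

theorem unif_real_Ioi {a : ℝ} (ha : a ∈ Ioo (0 : ℝ) 1) : unif.real (Ioi a) = 1 - a := by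
  have h : Ioi a ∩ Ioo 0 1 = Ioo a 1 := by
    ext u
    simp only [mem_inter_iff, mem_Ioi, mem_Ioo]
    exact ⟨fun h => ⟨h.1, h.2.2⟩, fun h => ⟨h.1, ha.1.trans h.1, h.2⟩⟩
  rw [measureReal_def, Measure.restrict_apply measurableSet_Ioi, h, Real.volume_Ioo,
    ENNReal.toReal_ofReal (by linarith [ha.2])]

theorem setIntegral_quantile_le {Z : E → ℝ} (hZm : AEMeasurable Z P) (hZ : Integrable Z P)
    {a : ℝ} (ha : a ∈ Ioo (0 : ℝ) 1) (c : ℝ) :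
    ∫ u in Ioi a, quantile (P.map Z) u ∂unif ≤ (1 - a) * c + ∫ e, max (Z e - c) 0 ∂P := by
  have hq := integrable_quantile_map hZm hZ
  have hq' : Integrable (fun u => max (quantile (P.map Z) u - c) 0) unif :=
    (hq.sub (integrable_const c)).pos_part
  rw [← integral_comp_quantile_map hZm (φ := fun z => max (z - c) 0) (by fun_prop)]
  calc ∫ u in Ioi a, quantile (P.map Z) u ∂unif
      ≤ ∫ u in Ioi a, (c + max (quantile (P.map Z) u - c) 0) ∂unif := by
        refine setIntegral_mono hq.integrableOn ((integrable_const c).add hq').integrableOn ?_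
        intro u
        have := le_max_left (quantile (P.map Z) u - c) 0
        simp only
        linarith
    _ = (1 - a) * c + ∫ u in Ioi a, max (quantile (P.map Z) u - c) 0 ∂unif := by
        rw [integral_add (integrable_const c).integrableOn hq'.integrableOn, setIntegral_const,
          unif_real_Ioi ha, smul_eq_mul]
    _ ≤ _ := by
        refine add_le_add_right (setIntegral_le_integral hq' ?_) _
        exact (Eventually.of_forall fun u => le_max_right _ _)

/-- At `c = F⁻¹(a)` the bound on the tail integral is attained. -/
theorem setIntegral_quantile_eq {Z : E → ℝ} (hZm : AEMeasurable Z P) (hZ : Integrable Z P)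
    {a : ℝ} (ha : a ∈ Ioo (0 : ℝ) 1) :
    ∫ u in Ioi a, quantile (P.map Z) u ∂unif = (1 - a) * quantile (P.map Z) a
      + ∫ e, max (Z e - quantile (P.map Z) a) 0 ∂P := by
  set c := quantile (P.map Z) a with hc
  have hq := integrable_quantile_map hZm hZ
  have hq' : Integrable (fun u => max (quantile (P.map Z) u - c) 0) unif :=
    (hq.sub (integrable_const c)).pos_part
  rw [← integral_comp_quantile_map hZm (φ := fun z => max (z - c) 0) (by fun_prop)]
  have h1 : ∫ u in Ioi a, quantile (P.map Z) u ∂unif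
      = ∫ u in Ioi a, (c + max (quantile (P.map Z) u - c) 0) ∂unif := by
    refine setIntegral_congr_ae measurableSet_Ioi ?_
    filter_upwards [ae_unif_mem_Ioo] with u hu hau
    rw [max_eq_left (sub_nonneg.2 (monotoneOn_quantile _ ha hu (le_of_lt hau)))]
    ring
  have h2 : ∫ u in Ioi a, max (quantile (P.map Z) u - c) 0 ∂unif
      = ∫ u, max (quantile (P.map Z) u - c) 0 ∂unif := by
    refine setIntegral_eq_integral_of_ae_compl_eq_zero ?_
    filter_upwards [ae_unif_mem_Ioo] with u hu hau
    exact max_eq_right (sub_nonpos.2 (monotoneOn_quantile _ hu ha (not_lt.1 hau)))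
  rw [h1, integral_add (integrable_const c).integrableOn hq'.integrableOn, setIntegral_const,
    unif_real_Ioi ha, smul_eq_mul, h2]

/-- A tail integral of the quantile function dominates the mean of the variable over any event of
the same probability. -/
theorem setIntegral_le_setIntegral_quantile {Z : E → ℝ} (hZm : AEMeasurable Z P)
    (hZ : Integrable Z P) {a : ℝ} (ha : a ∈ Ioo (0 : ℝ) 1) {A : Set E}
    (hPA : P.real A = 1 - a) :
    ∫ e in A, Z e ∂P ≤ ∫ u in Ioi a, quantile (P.map Z) u ∂unif := by
  rw [setIntegral_quantile_eq hZm hZ ha]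
  set c := quantile (P.map Z) a
  have hp : Integrable (fun e => max (Z e - c) 0) P := (hZ.sub (integrable_const c)).pos_part
  calc ∫ e in A, Z e ∂P ≤ ∫ e in A, (c + max (Z e - c) 0) ∂P := by
        refine setIntegral_mono hZ.integrableOn ((integrable_const c).add hp).integrableOn ?_
        intro e
        have := le_max_left (Z e - c) 0
        simp only
        linarith
    _ = (1 - a) * c + ∫ e in A, max (Z e - c) 0 ∂P := by
        rw [integral_add (integrable_const c).integrableOn hp.integrableOn, setIntegral_const,
          hPA, smul_eq_mul]
    _ ≤ _ := by
        refine add_le_add_right (setIntegral_le_integral hp ?_) _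
        exact (Eventually.of_forall fun u => le_max_right _ _)

/-- Directional derivative of distortion risk measures. If `Y` has a continuous distribution
function `F` and the perturbed variables `Z j` satisfy `|Z j - Y| ≤ C δ j` and
`(Z j - Y) / δ j → S`, then `∫ (F_{Z j}⁻¹ - F⁻¹) ζ / δ j → 𝔼[S ζ(F(Y))]`. For the indicator
`ζ = 1_{(a, 1)}` this is an envelope argument:
`𝔼[Z 1_A] ≤ ∫ₐ¹ F_Z⁻¹ ≤ (1 - a) c + 𝔼 (Z - c)⁺` whenever `ℙ(A) = 1 - a`, and at `Z = Y` both bounds are attained by `c = F⁻¹(a)` and `A = {Y > c}`. -/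
theorem tendsto_integral_quantile_difference_quotient {Y S : E → ℝ} {Z : ℕ → E → ℝ} {δ : ℕ → ℝ}
    {C : ℝ} (hYm : Measurable Y) (hY : Integrable Y P) [NullSingletonClass (P.map Y)]
    (hZm : ∀ j, AEMeasurable (Z j) P) (hS : AEStronglyMeasurable S P)
    (hδ : ∀ j, 0 < δ j) (hδ0 : Tendsto δ atTop (𝓝 0))
    (hC : ∀ j, ∀ᵐ e ∂P, |Z j e - Y e| ≤ C * δ j)
    (hlim : ∀ᵐ e ∂P, Tendsto (fun j => (Z j e - Y e) / δ j) atTop (𝓝 (S e)))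
    {ζ : ℝ → ℝ} (hζ : Integrable ζ unif) :
    Tendsto (fun j => ∫ u, (quantile (P.map (Z j)) u - quantile (P.map Y) u) / δ j * ζ u ∂unif)
      atTop (𝓝 (∫ e, S e * ζ (cdf (P.map Y) (Y e)) ∂P)) := by
  have hPY := Measure.isProbabilityMeasure_map (μ := P) hYm.aemeasurable
  have hdm : ∀ j, AEStronglyMeasurable (fun e => Z j e - Y e) P := fun j =>
    ((hZm j).sub hYm.aemeasurable).aestronglyMeasurable
  have hZ : ∀ j, Integrable (Z j) P := fun j => by
    have := (integrable_of_ae_bound (hdm j) (hC j)).add hY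
    refine this.congr (Eventually.of_forall fun e => ?_)
    simp
  have hbd : ∀ j, ∀ᵐ e ∂P, |(Z j e - Y e) / δ j| ≤ C := fun j => by
    filter_upwards [hC j] with e he
    rw [abs_div, abs_of_pos (hδ j)]
    exact (div_le_iff₀ (hδ j)).2 he
  have hF : ∀ j, AEStronglyMeasurable (fun e => (Z j e - Y e) / δ j) P := fun j =>
    ((hdm j).aemeasurable.div_const _).aestronglyMeasurable
  have hqm : ∀ j, AEStronglyMeasurable
      (fun u => (quantile (P.map (Z j)) u - quantile (P.map Y) u) / δ j) unif := fun j =>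
    (((aemeasurable_quantile _).sub (aemeasurable_quantile _)).div_const _).aestronglyMeasurable
  have hqb : ∀ j, ∀ᵐ u ∂unif,
      |(quantile (P.map (Z j)) u - quantile (P.map Y) u) / δ j| ≤ C := fun j => by
    filter_upwards [ae_unif_mem_Ioo] with u hu
    rw [abs_div, abs_of_pos (hδ j), div_le_iff₀ (hδ j)]
    exact abs_quantile_sub_le hYm.aemeasurable (hZm j) (hC j) hu
  have hSC : ∀ᵐ e ∂P, |S e| ≤ C := by
    filter_upwards [ae_all_iff.2 hbd, hlim] with e he hle
    exact le_of_tendsto hle.abs (Eventually.of_forall he)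
  have hU : Measurable fun e => cdf (P.map Y) (Y e) := (monotone_cdf _).measurable.comp hYm
  have hUlaw : P.map (fun e => cdf (P.map Y) (Y e)) = unif := by
    rw [← map_cdf_eq_unif (P.map Y), Measure.map_map (monotone_cdf _).measurable hYm]
    rfl
  have hqint := fun j => integrable_quantile_map (hZm j) (hZ j)
  have hqY := integrable_quantile_map hYm.aemeasurable hY
  have huniv : Tendsto
      (fun j => ∫ u, (quantile (P.map (Z j)) u - quantile (P.map Y) u) / δ j ∂unif)
      atTop (𝓝 (∫ e, S e ∂P)) := by
    have h1 : ∀ j, ∫ u, (quantile (P.map (Z j)) u - quantile (P.map Y) u) / δ j ∂unif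
        = ∫ e, (Z j e - Y e) / δ j ∂P := fun j => by
      rw [integral_div, integral_div, integral_sub (hqint j) hqY, integral_sub (hZ j) hY,
        integral_comp_quantile_map (hZm j) (φ := fun y => y) measurable_id',
        integral_comp_quantile_map hYm.aemeasurable (φ := fun y => y) measurable_id']
    simp_rw [h1]
    exact tendsto_integral_of_dominated_convergence (fun _ => C) hF (integrable_const C) hbd hlim
  refine tendsto_integral_mul_of_tendsto_setIntegral_Ioi hU hUlaw hqm hqb hS hSC (fun a => ?_)
    huniv hζ
  rcases le_or_gt a 0 with ha0 | ha0
  · -- the half-line has full measure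
    have h1 : unif.restrict (Ioi a) = unif := Measure.restrict_eq_self_of_ae_mem <| by
      filter_upwards [ae_unif_mem_Ioo] with u hu using lt_of_le_of_lt ha0 hu.1
    have h2 : P.restrict ((fun e => cdf (P.map Y) (Y e)) ⁻¹' Ioi a) = P :=
      Measure.restrict_eq_self_of_ae_mem <| by
        have : ∀ᵐ u ∂(P.map (fun e => cdf (P.map Y) (Y e))), u ∈ Ioo (0 : ℝ) 1 := by
          rw [hUlaw]; exact ae_unif_mem_Ioo
        filter_upwards [ae_of_ae_map hU.aemeasurable this] with e he
          using lt_of_le_of_lt ha0 he.1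
    rw [h1, h2]
    exact huniv
  rcases le_or_gt 1 a with ha1 | ha1
  · -- the half-line is a null set
    have h1 : unif.restrict (Ioi a) = 0 := Measure.restrict_eq_zero.2 <| by
      rw [Measure.restrict_apply measurableSet_Ioi]
      convert measure_empty (μ := (volume : Measure ℝ))
      ext u
      simp only [mem_inter_iff, mem_Ioi, mem_Ioo, mem_empty_iff_false, iff_false]
      rintro ⟨h1, _, h2⟩
      linarith
    have h2 : (fun e => cdf (P.map Y) (Y e)) ⁻¹' Ioi a = ∅ := by
      ext e
      simpa using (cdf_le_one (P.map Y) (Y e)).trans ha1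
    simp [h1, h2]
  have ha : a ∈ Ioo (0 : ℝ) 1 := ⟨ha0, ha1⟩
  set c := quantile (P.map Y) a with hc
  set A : Set E := {e | c < Y e} with hA
  have hAm : MeasurableSet A := measurableSet_lt measurable_const hYm
  have hcdf : cdf (P.map Y) c = a := cdf_quantile _ ha
  have hPA : P.real A = 1 - a := by
    have h1 : A = (Y ⁻¹' Iic c)ᶜ := by ext e; simp [hA]
    rw [h1, probReal_compl_eq_one_sub (hYm measurableSet_Iic), ← hcdf, cdf_eq_real,
      measureReal_def, measureReal_def, Measure.map_apply hYm measurableSet_Iic]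
  have hUA : ((fun e => cdf (P.map Y) (Y e)) ⁻¹' Ioi a : Set E) =ᵐ[P] A := by
    refine ae_eq_of_subset_of_measure_ge (fun e he => ?_) ?_
      (hU measurableSet_Ioi).nullMeasurableSet (measure_ne_top _ _)
    · by_contra h
      have h3 := monotone_cdf (P.map Y) (not_lt.1 h)
      rw [hcdf] at h3
      exact absurd (show a < cdf (P.map Y) (Y e) from he) (not_lt.2 h3)
    · rw [← ENNReal.toReal_le_toReal (measure_ne_top _ _) (measure_ne_top _ _)]
      rw [← Measure.map_apply hU measurableSet_Ioi, hUlaw]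
      exact (hPA.trans (unif_real_Ioi ha).symm).le
  rw [setIntegral_congr_set hUA]
  have hdiff : ∀ j, ∫ u in Ioi a, (quantile (P.map (Z j)) u - quantile (P.map Y) u) / δ j ∂unif
      = ((∫ u in Ioi a, quantile (P.map (Z j)) u ∂unif)
        - ∫ u in Ioi a, quantile (P.map Y) u ∂unif) / δ j := fun j => by
    rw [integral_div, integral_sub (hqint j).integrableOn hqY.integrableOn]
  have hYp : Integrable (fun e => max (Y e - c) 0) P := (hY.sub (integrable_const c)).pos_part
  have hZp : ∀ j, Integrable (fun e => max (Z j e - c) 0) P := fun j =>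
    ((hZ j).sub (integrable_const c)).pos_part
  have hYA : ∫ u in Ioi a, quantile (P.map Y) u ∂unif = ∫ e in A, Y e ∂P := by
    have h1 : ∫ e, max (Y e - c) 0 ∂P = ∫ e in A, (Y e - c) ∂P := by
      rw [← integral_indicator hAm]
      refine integral_congr_ae (Eventually.of_forall fun e => ?_)
      by_cases he : e ∈ A
      · simp only [indicator_of_mem he]
        exact max_eq_left (sub_nonneg.2 (le_of_lt he))
      · simp only [indicator_of_notMem he]
        exact max_eq_right (sub_nonpos.2 (not_lt.1 he))
    rw [setIntegral_quantile_eq hYm.aemeasurable hY ha, h1,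
      integral_sub hY.integrableOn (integrable_const c).integrableOn, setIntegral_const, hPA,
      smul_eq_mul]
    ring
  have hlow : ∀ j, ∫ e in A, (Z j e - Y e) / δ j ∂P
      ≤ ∫ u in Ioi a, (quantile (P.map (Z j)) u - quantile (P.map Y) u) / δ j ∂unif := fun j => by
    rw [hdiff, integral_div, integral_sub (hZ j).integrableOn hY.integrableOn, hYA]
    have := setIntegral_le_setIntegral_quantile (hZm j) (hZ j) ha hPA
    have := (hδ j).le
    gcongr
  have hupp : ∀ j, ∫ u in Ioi a, (quantile (P.map (Z j)) u - quantile (P.map Y) u) / δ j ∂unif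
      ≤ ∫ e, (max (Z j e - c) 0 - max (Y e - c) 0) / δ j ∂P := fun j => by
    rw [hdiff, integral_div, integral_sub (hZp j) hYp,
      setIntegral_quantile_eq hYm.aemeasurable hY ha]
    have := setIntegral_quantile_le (hZm j) (hZ j) ha c
    exact div_le_div_of_nonneg_right (by linarith) (hδ j).le
  have htlow : Tendsto (fun j => ∫ e in A, (Z j e - Y e) / δ j ∂P) atTop
      (𝓝 (∫ e in A, S e ∂P)) :=
    tendsto_integral_of_dominated_convergence (fun _ => C) (fun j => (hF j).restrict)
      (integrable_const C) (fun j => ae_restrict_of_ae (hbd j)) (ae_restrict_of_ae hlim)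
  have hYc : ∀ᵐ e ∂P, Y e ≠ c := by
    have : ∀ᵐ y ∂(P.map Y), y ≠ c := by
      rw [ae_iff]
      simp
    exact ae_of_ae_map hYm.aemeasurable this
  have htupp : Tendsto (fun j => ∫ e, (max (Z j e - c) 0 - max (Y e - c) 0) / δ j ∂P) atTop
      (𝓝 (∫ e in A, S e ∂P)) := by
    rw [← integral_indicator hAm]
    refine tendsto_integral_of_dominated_convergence (fun _ => C)
      (fun j => (((hZp j).sub hYp).1.aemeasurable.div_const _).aestronglyMeasurable)
      (integrable_const C) (fun j => ?_) ?_
    · filter_upwards [hbd j] with e he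
      refine le_trans ?_ he
      rw [Real.norm_eq_abs, abs_div, abs_div]
      refine div_le_div_of_nonneg_right ?_ (abs_nonneg _)
      refine (abs_max_sub_max_le_abs _ _ _).trans (le_of_eq ?_)
      congr 1
      ring
    · filter_upwards [hlim, hYc] with e he hec
      have hZY : Tendsto (fun j => Z j e) atTop (𝓝 (Y e)) := by
        have h := (he.mul hδ0).add_const (Y e)
        rw [mul_zero, zero_add] at h
        refine h.congr fun j => ?_
        rw [div_mul_cancel₀ _ (hδ j).ne']
        ring
      rcases lt_or_gt_of_ne hec with h | h
      · have hA' : e ∉ A := not_lt.2 h.le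
        rw [indicator_of_notMem hA']
        refine tendsto_const_nhds.congr' ?_
        filter_upwards [hZY.eventually (gt_mem_nhds h)] with j hj
        rw [max_eq_right (by linarith), max_eq_right (by linarith)]
        simp
      · have hA' : e ∈ A := h
        rw [indicator_of_mem hA']
        refine he.congr' ?_
        filter_upwards [hZY.eventually (lt_mem_nhds h)] with j hj
        rw [max_eq_left (by linarith), max_eq_left (by linarith)]
        ring
  exact tendsto_of_tendsto_of_tendsto_of_le_of_le htlow htupp hlow hupp

end QuantileDerivative

/-! ### Decision rules as conditional expectations, and their derivatives -/

section CondRank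

theorem measurable_uncurry_cdf {β : Type*} [MeasurableSpace β] (κ : Kernel β ℝ)
    [IsMarkovKernel κ] : Measurable fun p : β × ℝ => cdf (κ p.1) p.2 := by
  have h : Measurable fun p : β × ℝ =>
      (κ.comap Prod.fst measurable_fst) p (Prod.mk p ⁻¹' {q : (β × ℝ) × ℝ | q.2 ≤ q.1.2}) :=
    Kernel.measurable_kernel_prodMk_left
      (measurableSet_le measurable_snd (measurable_snd.comp measurable_fst))
  convert h.ennreal_toReal using 2 with p
  rw [cdf_eq_real]
  rfl

/-- Almost sure properties of `(X, T)` hold almost surely under the conditional laws of `T`. -/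
theorem ae_ae_condDistrib_of_ae {Ω β E : Type*} [MeasurableSpace Ω] [MeasurableSpace β]
    [MeasurableSpace E] [StandardBorelSpace E] [Nonempty E] {μ : Measure Ω} [IsFiniteMeasure μ]
    {X : Ω → β} (hX : Measurable X) {T : Ω → E} (hT : AEMeasurable T μ) {s : Set E}
    (hs : MeasurableSet s) (h : ∀ᵐ ω ∂μ, T ω ∈ s) :
    ∀ᵐ x ∂(μ.map X), ∀ᵐ e ∂(condDistrib T X μ x), e ∈ s := by
  refine Measure.ae_ae_of_ae_compProd (p := fun z : β × E => z.2 ∈ s) ?_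
  rw [compProd_map_condDistrib hT]
  exact (ae_map_iff (hX.aemeasurable.prodMk hT) (measurable_snd hs)).2 h

variable {Ω : Type*} [MeasurableSpace Ω] {μ : Measure Ω} [IsProbabilityMeasure μ] {m n : ℕ}
  {D : Ω → Fin m → ℝ} {X : Ω → Fin n → ℝ} {Y : Ω → ℝ}

theorem measurable_condRank (hX : Measurable X) (hY : Measurable Y) :
    Measurable (condRank μ X Y) :=
  (measurable_uncurry_cdf (condDistrib Y X μ)).comp (hX.prodMk hY)

/-- If the conditional distribution functions are continuous, the conditional rank is uniform and
independent of `X`. -/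
theorem measurePreserving_prodMk_condRank (hX : Measurable X) (hY : Measurable Y)
    (hU : ∀ᵐ x ∂(μ.map X), NullSingletonClass (condDistrib Y X μ x)) :
    MeasurePreserving (fun ω => (X ω, condRank μ X Y ω)) μ ((μ.map X).prod unif) := by
  have := Measure.isProbabilityMeasure_map (μ := μ) hX.aemeasurable
  refine ⟨hX.prodMk (measurable_condRank hX hY), (Measure.prod_eq fun s t hs ht => ?_).symm⟩
  have hH : Measurable fun p : (Fin n → ℝ) × ℝ => (p.1, cdf (condDistrib Y X μ p.1) p.2) :=
    measurable_fst.prodMk (measurable_uncurry_cdf _)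
  have h1 : μ.map (fun ω => (X ω, condRank μ X Y ω))
      = ((μ.map X) ⊗ₘ condDistrib Y X μ).map
        (fun p => (p.1, cdf (condDistrib Y X μ p.1) p.2)) := by
    rw [compProd_map_condDistrib hY.aemeasurable, Measure.map_map hH (hX.prodMk hY)]
    rfl
  rw [h1, Measure.map_apply hH (hs.prod ht), Measure.compProd_apply (hH (hs.prod ht))]
  have h2 : ∀ᵐ x ∂(μ.map X), condDistrib Y X μ x
      (Prod.mk x ⁻¹' ((fun p : (Fin n → ℝ) × ℝ => (p.1, cdf (condDistrib Y X μ p.1) p.2)) ⁻¹'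
        (s ×ˢ t))) = s.indicator (fun _ => unif t) x := by
    filter_upwards [hU] with x hx
    by_cases hxs : x ∈ s
    · rw [indicator_of_mem hxs, ← map_cdf_eq_unif (condDistrib Y X μ x),
        Measure.map_apply (monotone_cdf _).measurable ht]
      congr 1
      ext y
      simp [hxs]
    · rw [indicator_of_notMem hxs]
      convert measure_empty (μ := condDistrib Y X μ x)
      ext y
      simp [hxs]
  rw [lintegral_congr_ae h2, lintegral_indicator hs, setLIntegral_const, mul_comm]

namespace Weight.Admissible

variable {ℓ : Weight m n}

theorem memLp_rank_condRank (hℓ : ℓ.Admissible μ D X) (hX : Measurable X) (hY : Measurable Y)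
    (hU : ∀ᵐ x ∂(μ.map X), NullSingletonClass (condDistrib Y X μ x)) :
    MemLp (fun ω => ℓ.rank (X ω) (condRank μ X Y ω)) 2 μ :=
  hℓ.memLp_rank.comp_measurePreserving (measurePreserving_prodMk_condRank hX hY hU)

theorem memLp_realized (hℓ : ℓ.Admissible μ D X) (hX : Measurable X) (hY : Measurable Y)
    (hU : ∀ᵐ x ∂(μ.map X), NullSingletonClass (condDistrib Y X μ x)) :
    MemLp (ℓ.realized μ D X Y) 2 μ :=
  (hℓ.memLp_rank_condRank hX hY hU).add hℓ.memLp_state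

end Weight.Admissible

/-- A decision rule is the conditional expectation of the response, weighted by the realized
weight. -/
theorem decisionRule_ae_eq_condExp {ℓ : Weight m n} (hℓ : ℓ.Admissible μ D X)
    (hX : Measurable X) (hY : Measurable Y) (hY2 : MemLp Y 2 μ)
    (hU : ∀ᵐ x ∂(μ.map X), NullSingletonClass (condDistrib Y X μ x)) :
    decisionRule μ D X ℓ Y =ᵐ[μ] μ[fun ω => Y ω * ℓ.realized μ D X Y ω | sigmaX X] := by
  have hr := hℓ.memLp_rank_condRank hX hY hU
  have hYr : Integrable (fun ω => Y ω * ℓ.rank (X ω) (condRank μ X Y ω)) μ :=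
    hY2.integrable_mul hr
  have hYs : Integrable (fun ω => Y ω * ℓ.state (D ω) (X ω)) μ :=
    hY2.integrable_mul hℓ.memLp_state
  have hf : Measurable fun p : (Fin n → ℝ) × ℝ =>
      p.2 * ℓ.rank p.1 (cdf (condDistrib Y X μ p.1) p.2) :=
    measurable_snd.mul
      (hℓ.measurable_rank.comp (measurable_fst.prodMk (measurable_uncurry_cdf _)))
  have h1 := condExp_prod_ae_eq_integral_condDistrib hX hY.aemeasurable hf.stronglyMeasurable hYr
  have h2 : μ[fun ω => Y ω * ℓ.realized μ D X Y ω | sigmaX X] =ᵐ[μ]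
      μ[fun ω => Y ω * ℓ.rank (X ω) (condRank μ X Y ω) | sigmaX X]
        + μ[fun ω => Y ω * ℓ.state (D ω) (X ω) | sigmaX X] := by
    refine EventuallyEq.trans ?_ (condExp_add hYr hYs _)
    refine condExp_congr_ae (Eventually.of_forall fun ω => ?_)
    simp [Weight.realized, mul_add]
  filter_upwards [h1, h2, ae_of_ae_map hX.aemeasurable hU] with ω h1 h2 hν
  rw [h2, Pi.add_apply, decisionRule]
  congr 1
  rw [show μ[fun ω => Y ω * ℓ.rank (X ω) (condRank μ X Y ω) | sigmaX X] ω = _ from h1]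
  set ν := condDistrib Y X μ (X ω)
  have hφ : Measurable fun y : ℝ => y * ℓ.rank (X ω) (cdf ν y) :=
    hf.comp (measurable_prodMk_left (x := X ω))
  have h3 : ∫ y, y * ℓ.rank (X ω) (cdf ν y) ∂ν
      = ∫ u, quantile ν u * ℓ.rank (X ω) (cdf ν (quantile ν u)) ∂unif := by
    rw [← integral_map (φ := quantile ν) (f := fun y => y * ℓ.rank (X ω) (cdf ν y))
      (aemeasurable_quantile ν) hφ.aestronglyMeasurable, map_quantile_unif ν]
  rw [h3]
  refine integral_congr_ae ?_
  filter_upwards [ae_unif_mem_Ioo] with u hu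
  rw [cdf_quantile ν hu]

/-- Directional derivative of a decision rule: along perturbations `Z j` of the response with
`|Z j - Y| ≤ C δ j` and `(Z j - Y) / δ j → S` its difference quotients converge to the conditional
expectation of `S`, weighted by the realized weight. -/
theorem tendsto_decisionRule_difference_quotient {ℓ : Weight m n} (hℓ : ℓ.Admissible μ D X)
    (hD : Measurable D) (hX : Measurable X) (hY : Measurable Y) (hY2 : MemLp Y 2 μ)
    (hU : ∀ᵐ x ∂(μ.map X), NullSingletonClass (condDistrib Y X μ x))
    {S : Ω → ℝ} {Z : ℕ → Ω → ℝ} {δ : ℕ → ℝ} {C : ℝ} (hZ : ∀ j, AEMeasurable (Z j) μ)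
    (hS : AEMeasurable S μ) (hδ : ∀ j, 0 < δ j) (hδ0 : Tendsto δ atTop (𝓝 0))
    (hC : ∀ j, ∀ᵐ ω ∂μ, |Z j ω - Y ω| ≤ C * δ j)
    (hlim : ∀ᵐ ω ∂μ, Tendsto (fun j => (Z j ω - Y ω) / δ j) atTop (𝓝 (S ω))) :
    ∀ᵐ ω ∂μ, Tendsto
      (fun j => (decisionRule μ D X ℓ (Z j) ω - decisionRule μ D X ℓ Y ω) / δ j) atTop
      (𝓝 ((μ[fun ω => S ω * ℓ.realized μ D X Y ω | sigmaX X]) ω)) := by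
  have := Measure.isProbabilityMeasure_map (μ := μ) hX.aemeasurable
  set W : Ω → ℝ := fun ω => ℓ.state (D ω) (X ω) with hW
  have hWm : Measurable W := hℓ.measurable_state.comp (hD.prodMk hX)
  have hr := hℓ.memLp_rank_condRank hX hY hU
  -- the joint conditional law of all variables involved
  set T : Ω → ℝ × ℝ × ℝ × (ℕ → ℝ) := fun ω => (Y ω, W ω, S ω, fun j => Z j ω) with hTdef
  have hT : AEMeasurable T μ := hY.aemeasurable.prodMk
    (hWm.aemeasurable.prodMk (hS.prodMk (aemeasurable_pi_iff.2 hZ)))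
  set κ := condDistrib T X μ with hκ
  have hκY : ∀ᵐ x ∂(μ.map X), condDistrib Y X μ x = (κ x).map (fun e => e.1) := by
    filter_upwards [condDistrib_comp X hT (f := fun e => e.1) measurable_fst] with x hx
    rw [← Kernel.map_apply _ measurable_fst]
    exact hx
  have hκZ : ∀ j, ∀ᵐ x ∂(μ.map X), condDistrib (Z j) X μ x = (κ x).map (fun e => e.2.2.2 j) := by
    intro j
    have hm : Measurable fun e : ℝ × ℝ × ℝ × (ℕ → ℝ) => e.2.2.2 j := by fun_prop
    filter_upwards [condDistrib_comp X hT hm] with x hx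
    rw [← Kernel.map_apply _ hm]
    exact hx
  have hκC : ∀ᵐ x ∂(μ.map X), ∀ j, ∀ᵐ e ∂(κ x), |e.2.2.2 j - e.1| ≤ C * δ j :=
    ae_all_iff.2 fun j => ae_ae_condDistrib_of_ae (s := {e | |e.2.2.2 j - e.1| ≤ C * δ j}) hX hT
      (measurableSet_le (by fun_prop) measurable_const) (hC j)
  have hκlim : ∀ᵐ x ∂(μ.map X), ∀ᵐ e ∂(κ x),
      Tendsto (fun j => (e.2.2.2 j - e.1) / δ j) atTop (𝓝 e.2.2.1) := by
    have hs : MeasurableSet {e : ℝ × ℝ × ℝ × (ℕ → ℝ) |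
        Tendsto (fun j => (e.2.2.2 j - e.1) / δ j - e.2.2.1) atTop (𝓝 0)} :=
      measurableSet_tendsto (𝓝 (0 : ℝ)) (fun j => by fun_prop)
    have h := ae_ae_condDistrib_of_ae hX hT hs (by
      filter_upwards [hlim] with ω hω
      exact tendsto_sub_nhds_zero_iff.2 hω)
    filter_upwards [h] with x hx
    filter_upwards [hx] with e he
    exact tendsto_sub_nhds_zero_iff.1 he
  have hYW : Integrable (fun ω => Y ω * W ω) μ := hY2.integrable_mul hℓ.memLp_state
  have hdm : ∀ j, AEStronglyMeasurable (fun ω => Z j ω - Y ω) μ := fun j =>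
    ((hZ j).sub hY.aemeasurable).aestronglyMeasurable
  have hWi : Integrable W μ := hℓ.memLp_state.integrable (by norm_num)
  have hZW : ∀ j, Integrable (fun ω => Z j ω * W ω) μ := fun j => by
    have h := hWi.bdd_mul (hdm j) (c := C * δ j) (by simpa using hC j)
    refine (h.add hYW).congr (Eventually.of_forall fun ω => ?_)
    simp only [Pi.add_apply]
    ring
  have hSC : ∀ᵐ ω ∂μ, |S ω| ≤ C := by
    filter_upwards [ae_all_iff.2 hC, hlim] with ω h1 h2
    refine le_of_tendsto h2.abs (Eventually.of_forall fun j => ?_)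
    rw [abs_div, abs_of_pos (hδ j)]
    exact (div_le_iff₀ (hδ j)).2 (h1 j)
  have hSW : Integrable (fun ω => S ω * W ω) μ :=
    hWi.bdd_mul hS.aestronglyMeasurable (c := C) (by simpa using hSC)
  have hSr : Integrable (fun ω => S ω * ℓ.rank (X ω) (condRank μ X Y ω)) μ :=
    (hr.integrable (by norm_num)).bdd_mul hS.aestronglyMeasurable (c := C) (by simpa using hSC)
  have hfr : Measurable fun p : (Fin n → ℝ) × (ℝ × ℝ × ℝ × (ℕ → ℝ)) =>
      p.2.2.2.1 * ℓ.rank p.1 (cdf (condDistrib Y X μ p.1) p.2.1) := by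
    have h1 : Measurable fun p : (Fin n → ℝ) × (ℝ × ℝ × ℝ × (ℕ → ℝ)) => (p.1, p.2.1) := by
      fun_prop
    have h2 : Measurable fun p : (Fin n → ℝ) × (ℝ × ℝ × ℝ × (ℕ → ℝ)) => p.2.2.2.1 := by
      fun_prop
    exact h2.mul (hℓ.measurable_rank.comp
      (measurable_fst.prodMk ((measurable_uncurry_cdf (condDistrib Y X μ)).comp h1)))
  -- the conditional expectations as integrals against the conditional law
  have hEr := condExp_prod_ae_eq_integral_condDistrib hX hT hfr.stronglyMeasurable hSr
  have hmSW : Measurable fun e : ℝ × ℝ × ℝ × (ℕ → ℝ) => e.2.2.1 * e.2.1 := by fun_prop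
  have hmYW : Measurable fun e : ℝ × ℝ × ℝ × (ℕ → ℝ) => e.1 * e.2.1 := by fun_prop
  have hmZW : ∀ j, Measurable fun e : ℝ × ℝ × ℝ × (ℕ → ℝ) => e.2.2.2 j * e.2.1 := by fun_prop
  have hESW := condExp_ae_eq_integral_condDistrib hX hT hmSW.stronglyMeasurable hSW
  have hEYW := condExp_ae_eq_integral_condDistrib hX hT hmYW.stronglyMeasurable hYW
  have hEZW := fun j =>
    condExp_ae_eq_integral_condDistrib hX hT (hmZW j).stronglyMeasurable (hZW j)
  have hEsum : μ[fun ω => S ω * ℓ.realized μ D X Y ω | sigmaX X] =ᵐ[μ]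
      μ[fun ω => S ω * ℓ.rank (X ω) (condRank μ X Y ω) | sigmaX X]
        + μ[fun ω => S ω * W ω | sigmaX X] := by
    refine EventuallyEq.trans ?_ (condExp_add hSr hSW _)
    refine condExp_congr_ae (Eventually.of_forall fun ω => ?_)
    simp [Weight.realized, mul_add, hW]
  -- integrability under the conditional law
  have key : ∀ {f : ℝ × ℝ × ℝ × (ℕ → ℝ) → ℝ}, Measurable f → Integrable (fun ω => f (T ω)) μ →
      ∀ᵐ ω ∂μ, Integrable f (κ (X ω)) := fun {f} hf hfi => by
    refine Integrable.condDistrib_ae (f := fun p : (Fin n → ℝ) × _ => f p.2) hX.aemeasurable hT ?_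
    exact (integrable_map_measure (hf.comp measurable_snd).aestronglyMeasurable
      (hX.aemeasurable.prodMk hT)).2 hfi
  have hiY : ∀ᵐ ω ∂μ, Integrable (fun e => e.1) (κ (X ω)) :=
    key (f := fun e => e.1) measurable_fst (hY2.integrable (by norm_num))
  have hiW := key (f := fun e => e.2.1) (by fun_prop) hWi
  have hiYW := key hmYW hYW
  have hiZW := ae_all_iff.2 fun j => key (hmZW j) (hZW j)
  have hfY : Measurable fun p : (Fin n → ℝ) × ℝ =>
      p.2 * ℓ.rank p.1 (cdf (condDistrib Y X μ p.1) p.2) :=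
    measurable_snd.mul
      (hℓ.measurable_rank.comp (measurable_fst.prodMk (measurable_uncurry_cdf _)))
  have hiYr : ∀ᵐ ω ∂μ, Integrable (fun y => y * ℓ.rank (X ω) (cdf (condDistrib Y X μ (X ω)) y))
      (condDistrib Y X μ (X ω)) :=
    Integrable.condDistrib_ae hX.aemeasurable hY.aemeasurable
      ((integrable_map_measure hfY.aestronglyMeasurable (hX.prodMk hY).aemeasurable).2
        (hY2.integrable_mul hr))
  have hirank : ∀ᵐ ω ∂μ, Integrable (fun u => ℓ.rank (X ω) u) unif :=
    ae_of_ae_map hX.aemeasurable (hℓ.memLp_rank.integrable (by norm_num)).prod_right_ae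
  have tr := fun {p : (Fin n → ℝ) → Prop} (h : ∀ᵐ x ∂(μ.map X), p x) =>
    ae_of_ae_map hX.aemeasurable h
  filter_upwards [tr hκY, tr (ae_all_iff.2 hκZ), tr hκC, tr hκlim, tr hU, hEr, hESW, hEYW,
    ae_all_iff.2 hEZW, hEsum, hiY, hiW, hiYW, hiZW, hiYr, hirank] with ω hκY hκZ hκC hκlim hU hEr
    hESW hEYW hEZW hEsum hiY hiW hiYW hiZW hiYr hirank
  have hEr' : μ[fun ω => S ω * ℓ.rank (X ω) (condRank μ X Y ω) | sigmaX X] ω = _ := hEr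
  rw [hEsum, Pi.add_apply, hEr', hESW]
  set ν := condDistrib Y X μ (X ω) with hν
  set P := κ (X ω) with hP
  have hZm : ∀ j, Measurable fun e : ℝ × ℝ × ℝ × (ℕ → ℝ) => e.2.2.2 j := fun j => by fun_prop
  have hcls : NullSingletonClass (P.map fun e => e.1) := hκY ▸ hU
  have hrk := tendsto_integral_quantile_difference_quotient (P := P) (Y := fun e => e.1)
    (S := fun e => e.2.2.1) (Z := fun j e => e.2.2.2 j) measurable_fst hiY
    (fun j => (hZm j).aemeasurable)
    (by fun_prop : Measurable fun e : ℝ × ℝ × ℝ × (ℕ → ℝ) => e.2.2.1).aestronglyMeasurable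
    hδ hδ0 hκC hκlim hirank
  have hst : Tendsto (fun j => ∫ e, (e.2.2.2 j - e.1) / δ j * e.2.1 ∂P) atTop
      (𝓝 (∫ e, e.2.2.1 * e.2.1 ∂P)) := by
    refine tendsto_integral_of_dominated_convergence (fun e => C * |e.2.1|)
      (fun j => (by fun_prop : Measurable fun e : ℝ × ℝ × ℝ × (ℕ → ℝ) =>
        (e.2.2.2 j - e.1) / δ j * e.2.1).aestronglyMeasurable)
      (hiW.abs.const_mul C) (fun j => ?_) ?_
    · filter_upwards [hκC j] with e he
      rw [Real.norm_eq_abs, abs_mul, abs_div, abs_of_pos (hδ j)]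
      exact mul_le_mul_of_nonneg_right ((div_le_iff₀ (hδ j)).2 he) (abs_nonneg _)
    · filter_upwards [hκlim] with e he using he.mul_const _
  rw [← hκY] at hrk
  refine (hrk.add hst).congr fun j => ?_
  have hqY : Integrable (fun u => quantile ν u * ℓ.rank (X ω) u) unif := by
    rw [← map_quantile_unif ν] at hiYr
    have h := (integrable_map_measure hiYr.1 (aemeasurable_quantile ν)).1 hiYr
    refine h.congr ?_
    filter_upwards [ae_unif_mem_Ioo] with u hu
    simp only [Function.comp_apply, map_quantile_unif ν, cdf_quantile ν hu]
  have hqd : Integrable (fun u => (quantile (P.map fun e => e.2.2.2 j) u - quantile ν u)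
      * ℓ.rank (X ω) u) unif := by
    refine hirank.bdd_mul (c := C * δ j)
      ((aemeasurable_quantile _).sub (aemeasurable_quantile _)).aestronglyMeasurable ?_
    filter_upwards [ae_unif_mem_Ioo] with u hu
    rw [hκY]
    exact abs_quantile_sub_le measurable_fst.aemeasurable (hZm j).aemeasurable (hκC j) hu
  have hqZ : Integrable (fun u => quantile (P.map fun e => e.2.2.2 j) u * ℓ.rank (X ω) u)
      unif := by
    refine (hqd.add hqY).congr (Eventually.of_forall fun u => ?_)
    simp only [Pi.add_apply]
    ring
  have e1 : ∫ u, (quantile (P.map fun e => e.2.2.2 j) u - quantile ν u) / δ j * ℓ.rank (X ω) u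
      ∂unif = ((∫ u, quantile (P.map fun e => e.2.2.2 j) u * ℓ.rank (X ω) u ∂unif)
        - ∫ u, quantile ν u * ℓ.rank (X ω) u ∂unif) / δ j := by
    rw [← integral_sub hqZ hqY, ← integral_div]
    congr with u
    ring
  have e2 : ∫ e, (e.2.2.2 j - e.1) / δ j * e.2.1 ∂P
      = ((∫ e, e.2.2.2 j * e.2.1 ∂P) - ∫ e, e.1 * e.2.1 ∂P) / δ j := by
    rw [← integral_sub (hiZW j) hiYW, ← integral_div]
    congr with e
    ring
  have hEZ : μ[fun ω' => Z j ω' * ℓ.state (D ω') (X ω') | sigmaX X] ω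
    = ∫ e, e.2.2.2 j * e.2.1 ∂P := hEZW j
  have hEY : μ[fun ω' => Y ω' * ℓ.state (D ω') (X ω') | sigmaX X] ω
    = ∫ e, e.1 * e.2.1 ∂P := hEYW
  rw [e1, e2, decisionRule, decisionRule, hκZ j, hEZ, hEY]
  ring

end CondRank

/-! ### Conditional projections in `L²` -/

section ConditionalProjection

variable {Ω : Type*} {m₀ mΩ : MeasurableSpace Ω} {μ : Measure Ω}

/-- Pulling known factors out of a conditional expectation, when only the whole sum is known to be
integrable. -/
theorem condExp_sum_mul_of_integrable_sum {ι : Type*} [Fintype ι] (hm : m₀ ≤ mΩ)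
    {ξ F : ι → Ω → ℝ} (hξ : ∀ l, StronglyMeasurable[m₀] (ξ l)) (hF : ∀ l, Integrable (F l) μ)
    (hsum : Integrable (fun ω => ∑ l, ξ l ω * F l ω) μ) :
    μ[fun ω => ∑ l, ξ l ω * F l ω | m₀] =ᵐ[μ] fun ω => ∑ l, ξ l ω * (μ[F l | m₀]) ω := by
  -- multiplication by a positive known factor makes all coefficients bounded
  set h : Ω → ℝ := fun ω => (1 + ∑ l, |ξ l ω|)⁻¹ with hh
  have hpos : ∀ ω, 0 < 1 + ∑ l, |ξ l ω| := fun ω => by positivity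
  have hhm : StronglyMeasurable[m₀] h := by
    refine (Measurable.inv ?_).stronglyMeasurable
    exact measurable_const.add
      (Finset.measurable_sum _ fun l _ => continuous_abs.measurable.comp (hξ l).measurable)
  have hh1 : ∀ ω, |h ω| ≤ 1 := fun ω => by
    rw [hh, abs_inv, abs_of_pos (hpos ω)]
    exact inv_le_one_of_one_le₀ (le_add_of_nonneg_right (by positivity))
  have hhξ : ∀ l ω, |h ω * ξ l ω| ≤ 1 := fun l ω => by
    rw [hh, abs_mul, abs_inv, abs_of_pos (hpos ω), inv_mul_le_iff₀ (hpos ω), mul_one]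
    have := Finset.single_le_sum (f := fun l => |ξ l ω|) (fun _ _ => abs_nonneg _)
      (Finset.mem_univ l)
    linarith
  have h1 : μ[h * fun ω => ∑ l, ξ l ω * F l ω | m₀] =ᵐ[μ]
      h * μ[fun ω => ∑ l, ξ l ω * F l ω | m₀] :=
    condExp_mul_of_stronglyMeasurable_left hhm
      (hsum.bdd_mul (hhm.mono hm).aestronglyMeasurable (c := 1) (Eventually.of_forall hh1)) hsum
  have hlm : ∀ l, StronglyMeasurable[m₀] (h * ξ l) := fun l => hhm.mul (hξ l)
  have hli : ∀ l, Integrable ((h * ξ l) * F l) μ := fun l =>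
    (hF l).bdd_mul ((hlm l).mono hm).aestronglyMeasurable (c := 1)
      (Eventually.of_forall fun ω => hhξ l ω)
  have h2 : ∀ l, μ[(h * ξ l) * F l | m₀] =ᵐ[μ] (h * ξ l) * μ[F l | m₀] := fun l =>
    condExp_mul_of_stronglyMeasurable_left (hlm l) (hli l) (hF l)
  have h3 : (h * fun ω => ∑ l, ξ l ω * F l ω) = ∑ l, (h * ξ l) * F l := by
    ext ω
    simp only [Pi.mul_apply, Finset.sum_apply, Finset.mul_sum, mul_assoc]
  have h4 : μ[∑ l, (h * ξ l) * F l | m₀] =ᵐ[μ] ∑ l, μ[(h * ξ l) * F l | m₀] :=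
    condExp_finsetSum (fun l _ => hli l) m₀
  rw [h3] at h1
  filter_upwards [h1, ae_all_iff.2 h2, h4] with ω h1 h2 h4
  rw [h4, Finset.sum_apply, Pi.mul_apply] at h1
  have hne : h ω ≠ 0 := (inv_pos.2 (hpos ω)).ne'
  refine mul_left_cancel₀ hne ?_
  rw [← h1, Finset.mul_sum]
  refine Finset.sum_congr rfl fun l _ => ?_
  rw [h2 l]
  simp only [Pi.mul_apply]
  ring

/-- Where `𝔼[T² | m₀]` vanishes, so does `T`. -/
theorem condExp_mul_eq_zero_of_sq_eq_zero [IsFiniteMeasure μ] (hm : m₀ ≤ mΩ) {r T : Ω → ℝ}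
    (hr : MemLp r 2 μ) (hT : MemLp T 2 μ) :
    ∀ᵐ ω ∂μ, (μ[fun ω => T ω ^ 2 | m₀]) ω = 0 → (μ[fun ω => T ω * r ω | m₀]) ω = 0 := by
  set A : Set Ω := {ω | (μ[fun ω => T ω ^ 2 | m₀]) ω = 0} with hA
  have hAm : MeasurableSet[m₀] A :=
    stronglyMeasurable_condExp.measurable (measurableSet_singleton 0)
  have hT2 : Integrable (fun ω => T ω ^ 2) μ := hT.integrable_sq
  have hTr : Integrable (fun ω => T ω * r ω) μ := hT.integrable_mul hr
  have h0 : ∫ ω in A, T ω ^ 2 ∂μ = 0 := by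
    rw [← setIntegral_condExp hm hT2 hAm]
    exact setIntegral_eq_zero_of_forall_eq_zero fun ω hω => hω
  have h1 : ∀ᵐ ω ∂μ, ω ∈ A → T ω = 0 := by
    have := (setIntegral_eq_zero_iff_of_nonneg_ae
      (Eventually.of_forall fun ω => sq_nonneg (T ω)) hT2.integrableOn).1 h0
    filter_upwards [(ae_restrict_iff' (hm _ hAm)).1 this] with ω hω hωA
    exact pow_eq_zero_iff (two_ne_zero) |>.1 (hω hωA)
  have h2 : A.indicator (fun ω => T ω * r ω) =ᵐ[μ] 0 := by
    filter_upwards [h1] with ω hω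
    by_cases h : ω ∈ A
    · simp [h, hω h]
    · simp [h]
  have h3 := condExp_indicator hTr hAm
  have h4 : μ[A.indicator fun ω => T ω * r ω | m₀] =ᵐ[μ] 0 :=
    (condExp_congr_ae h2).trans (by rw [condExp_zero])
  filter_upwards [h3, h4] with ω h3 h4 hω
  rw [h3, indicator_of_mem (show ω ∈ A from hω)] at h4
  exact h4

/-- The conditional regression coefficient of `r` on `T` given `m₀`. Where `𝔼[T² | m₀]` vanishes, so
does `𝔼[T r | m₀]`, and division by zero gives the coefficient `0`, which is a valid choice. -/
noncomputable def condCoeff (m₀ : MeasurableSpace Ω) {mΩ : MeasurableSpace Ω} (μ : Measure Ω)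
    (r T : Ω → ℝ) (ω : Ω) : ℝ :=
  (μ[fun ω => T ω * r ω | m₀]) ω / (μ[fun ω => T ω ^ 2 | m₀]) ω

theorem stronglyMeasurable_condCoeff (r T : Ω → ℝ) :
    StronglyMeasurable[m₀] (condCoeff m₀ μ r T) :=
  stronglyMeasurable_condExp.div stronglyMeasurable_condExp

theorem condCoeff_mul_condExp_sq [IsFiniteMeasure μ] (hm : m₀ ≤ mΩ) {r T : Ω → ℝ} (hr : MemLp r 2 μ)
    (hT : MemLp T 2 μ) : ∀ᵐ ω ∂μ, condCoeff m₀ μ r T ω * (μ[fun ω => T ω ^ 2 | m₀]) ω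
      = (μ[fun ω => T ω * r ω | m₀]) ω := by
  filter_upwards [condExp_mul_eq_zero_of_sq_eq_zero hm hr hT] with ω hω
  rw [condCoeff]
  by_cases h : (μ[fun ω => T ω ^ 2 | m₀]) ω = 0
  · rw [hω h]; simp
  · exact div_mul_cancel₀ _ h

/-- The regression of `r` on `T` is square-integrable: on the events where the coefficient `b` is
bounded, `𝔼[(bT)²] = 𝔼[bTr] ≤ (𝔼[(bT)²] + 𝔼[r²]) / 2`. -/
theorem memLp_condCoeff_mul [IsFiniteMeasure μ] (hm : m₀ ≤ mΩ) {r T : Ω → ℝ} (hr : MemLp r 2 μ)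
    (hT : MemLp T 2 μ) : MemLp (fun ω => condCoeff m₀ μ r T ω * T ω) 2 μ := by
  set b := condCoeff m₀ μ r T with hb
  have hbm : StronglyMeasurable[m₀] b := stronglyMeasurable_condCoeff r T
  have hT2 : Integrable (fun ω => T ω ^ 2) μ := hT.integrable_sq
  have hr2 : Integrable (fun ω => r ω ^ 2) μ := hr.integrable_sq
  have hTr : Integrable (fun ω => T ω * r ω) μ := hT.integrable_mul hr
  set A : ℕ → Set Ω := fun N => {ω | |b ω| ≤ N} with hA
  have hAm : ∀ N, MeasurableSet[m₀] (A N) := fun N =>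
    (continuous_abs.measurable.comp hbm.measurable) measurableSet_Iic
  set c : ℕ → Ω → ℝ := fun N => (A N).indicator b with hc
  have hcm : ∀ N, StronglyMeasurable[m₀] (c N) := fun N => hbm.indicator (hAm N)
  have hcb : ∀ N ω, |c N ω| ≤ N := fun N ω => by
    by_cases h : ω ∈ A N
    · rw [hc]
      simp only [indicator_of_mem h]
      exact h
    · simp [hc, h]
  have hcbm : ∀ N ω, c N ω ^ 2 = c N ω * b ω := fun N ω => by
    by_cases h : ω ∈ A N
    · simp [hc, h, sq]
    · simp [hc, h]
  have hcT2 : ∀ N, Integrable ((fun ω => c N ω ^ 2) * fun ω => T ω ^ 2) μ := fun N => by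
    refine hT2.bdd_mul (c := (N : ℝ) ^ 2) (((hcm N).pow 2).mono hm).aestronglyMeasurable
      (Eventually.of_forall fun ω => ?_)
    rw [Real.norm_eq_abs, abs_pow]
    exact pow_le_pow_left₀ (abs_nonneg _) (hcb N ω) 2
  have hcTr : ∀ N, Integrable ((c N) * fun ω => T ω * r ω) μ := fun N =>
    hTr.bdd_mul (c := (N : ℝ)) ((hcm N).mono hm).aestronglyMeasurable
      (Eventually.of_forall (hcb N))
  have hbound : ∀ N, ∫ ω, (c N ω * T ω) ^ 2 ∂μ ≤ ∫ ω, r ω ^ 2 ∂μ := fun N => by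
    have h1 : ∫ ω, c N ω ^ 2 * T ω ^ 2 ∂μ = ∫ ω, c N ω * (T ω * r ω) ∂μ := by
      have e1 : μ[(fun ω => c N ω ^ 2) * fun ω => T ω ^ 2 | m₀] =ᵐ[μ]
          (fun ω => c N ω ^ 2) * μ[fun ω => T ω ^ 2 | m₀] :=
        condExp_mul_of_stronglyMeasurable_left ((hcm N).pow 2) (hcT2 N) hT2
      have e2 : μ[(c N) * fun ω => T ω * r ω | m₀] =ᵐ[μ]
          (c N) * μ[fun ω => T ω * r ω | m₀] :=
        condExp_mul_of_stronglyMeasurable_left (hcm N) (hcTr N) hTr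
      have e3 : ∫ ω, ((fun ω => c N ω ^ 2) * fun ω => T ω ^ 2) ω ∂μ
          = ∫ ω, ((c N) * fun ω => T ω * r ω) ω ∂μ := by
        rw [← integral_condExp hm, ← integral_condExp hm (f := (c N) * fun ω => T ω * r ω)]
        refine integral_congr_ae ?_
        filter_upwards [e1, e2, condCoeff_mul_condExp_sq hm hr hT] with ω e1 e2 e
        rw [e1, e2, Pi.mul_apply, Pi.mul_apply, hcbm, mul_assoc, e]
      exact e3
    have hi : Integrable (fun ω => (c N ω * T ω) ^ 2) μ :=
      (hcT2 N).congr (Eventually.of_forall fun ω => (mul_pow _ _ _).symm)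
    have h2 : ∫ ω, (c N ω * T ω) ^ 2 ∂μ = ∫ ω, c N ω * (T ω * r ω) ∂μ := by
      simpa only [mul_pow] using h1
    have h3 : ∫ ω, c N ω * (T ω * r ω) ∂μ ≤ ∫ ω, ((c N ω * T ω) ^ 2 + r ω ^ 2) / 2 ∂μ := by
      refine integral_mono (hcTr N) ((hi.add hr2).div_const 2) fun ω => ?_
      simp only
      nlinarith [sq_nonneg (c N ω * T ω - r ω)]
    rw [integral_div, integral_add hi hr2] at h3
    linarith
  have hmeas : AEStronglyMeasurable (fun ω => b ω * T ω) μ :=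
    (hbm.mono hm).aestronglyMeasurable.mul hT.1
  rw [memLp_two_iff_integrable_sq hmeas]
  refine ⟨hmeas.pow 2, ?_⟩
  have hlim : ∀ ω, Tendsto (fun N => ‖(c N ω * T ω) ^ 2‖ₑ) atTop (𝓝 ‖(b ω * T ω) ^ 2‖ₑ) := by
    intro ω
    refine tendsto_const_nhds.congr' ?_
    filter_upwards [eventually_ge_atTop ⌈|b ω|⌉₊] with N hN
    have h : ω ∈ A N := Nat.ceil_le.1 hN
    rw [hc]
    simp only [indicator_of_mem h]
  have hi : ∀ N, Integrable (fun ω => (c N ω * T ω) ^ 2) μ := fun N =>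
    (hcT2 N).congr (Eventually.of_forall fun ω => (mul_pow _ _ _).symm)
  have hle : ∀ N, ∫⁻ ω, ‖(c N ω * T ω) ^ 2‖ₑ ∂μ ≤ ENNReal.ofReal (∫ ω, r ω ^ 2 ∂μ) := by
    intro N
    rw [← ofReal_integral_norm_eq_lintegral_enorm (hi N)]
    refine ENNReal.ofReal_le_ofReal (le_trans (le_of_eq ?_) (hbound N))
    exact integral_congr_ae (Eventually.of_forall fun ω => Real.norm_of_nonneg (sq_nonneg _))
  calc ∫⁻ ω, ‖(b ω * T ω) ^ 2‖ₑ ∂μ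
      = ∫⁻ ω, liminf (fun N => ‖(c N ω * T ω) ^ 2‖ₑ) atTop ∂μ :=
        lintegral_congr fun ω => ((hlim ω).liminf_eq).symm
    _ ≤ liminf (fun N => ∫⁻ ω, ‖(c N ω * T ω) ^ 2‖ₑ ∂μ) atTop :=
        lintegral_liminf_le' fun N => (hi N).1.enorm
    _ ≤ ENNReal.ofReal (∫ ω, r ω ^ 2 ∂μ) :=
        liminf_le_of_frequently_le' (Frequently.of_forall hle)
    _ < ⊤ := ENNReal.ofReal_lt_top

/-- The regression residual is conditionally orthogonal to the regressor. -/
theorem condExp_mul_sub_condCoeff_mul [IsFiniteMeasure μ] (hm : m₀ ≤ mΩ) {r T : Ω → ℝ}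
    (hr : MemLp r 2 μ) (hT : MemLp T 2 μ) :
    μ[fun ω => T ω * (r ω - condCoeff m₀ μ r T ω * T ω) | m₀] =ᵐ[μ] 0 := by
  have hTr : Integrable (fun ω => T ω * r ω) μ := hT.integrable_mul hr
  have hbT := memLp_condCoeff_mul hm hr hT
  have hbT2 : Integrable (condCoeff m₀ μ r T * fun ω => T ω ^ 2) μ :=
    (hbT.integrable_mul hT).congr (Eventually.of_forall fun ω => by
      simp only [Pi.mul_apply]; ring)
  have h1 : (fun ω => T ω * (r ω - condCoeff m₀ μ r T ω * T ω))
      = (fun ω => T ω * r ω) - condCoeff m₀ μ r T * fun ω => T ω ^ 2 := by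
    ext ω
    simp only [Pi.sub_apply, Pi.mul_apply]
    ring
  rw [h1]
  filter_upwards [condExp_sub hTr hbT2 m₀, condCoeff_mul_condExp_sq hm hr hT,
    condExp_mul_of_stronglyMeasurable_left (stronglyMeasurable_condCoeff r T) hbT2
      hT.integrable_sq] with ω h2 h3 h4
  rw [h2, Pi.sub_apply, h4, Pi.mul_apply, h3]
  simp

/-- Existence of the conditional projection: every square-integrable `r` can be made conditionally
orthogonal to finitely many square-integrable `S i` by subtracting a combination of them with
`m₀`-measurable coefficients. No nondegeneracy is required; the coefficients are found by the
Gram–Schmidt procedure, adding one variable at a time. -/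
theorem exists_condExp_mul_sub_sum_eq_zero [IsFiniteMeasure μ] (hm : m₀ ≤ mΩ) :
    ∀ {k : ℕ} (S : Fin k → Ω → ℝ), (∀ i, MemLp (S i) 2 μ) → ∀ r : Ω → ℝ, MemLp r 2 μ →
      ∃ η : Fin k → Ω → ℝ, (∀ l, StronglyMeasurable[m₀] (η l)) ∧
        MemLp (fun ω => ∑ l, η l ω * S l ω) 2 μ ∧
        ∀ i, μ[fun ω => S i ω * (r ω - ∑ l, η l ω * S l ω) | m₀] =ᵐ[μ] 0 := by
  intro k
  induction k with
  | zero => exact fun S hS r hr => ⟨0, fun l => l.elim0, by simp, fun i => i.elim0⟩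
  | succ k ih =>
    intro S hS r hr
    have hS' : ∀ i : Fin k, MemLp (S i.succ) 2 μ := fun i => hS i.succ
    obtain ⟨η, hηm, hη2, hη⟩ := ih (fun i => S i.succ) hS' r hr
    obtain ⟨ξ, hξm, hξ2, hξ⟩ := ih (fun i => S i.succ) hS' (S 0) (hS 0)
    set T : Ω → ℝ := fun ω => S 0 ω - ∑ l, ξ l ω * S (Fin.succ l) ω with hT
    set r₁ : Ω → ℝ := fun ω => r ω - ∑ l, η l ω * S (Fin.succ l) ω with hr₁
    have hT2 : MemLp T 2 μ := (hS 0).sub hξ2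
    have hr₁2 : MemLp r₁ 2 μ := hr.sub hη2
    set b := condCoeff m₀ μ r₁ T with hb
    have hbm : StronglyMeasurable[m₀] b := stronglyMeasurable_condCoeff r₁ T
    have hbT : MemLp (fun ω => b ω * T ω) 2 μ := memLp_condCoeff_mul hm hr₁2 hT2
    have hsum : ∀ ω, ∑ l, (Fin.cons b (fun l => η l - b * ξ l) : Fin (k + 1) → Ω → ℝ) l ω * S l ω
        = (∑ l, η l ω * S (Fin.succ l) ω) + b ω * T ω := fun ω => by
      rw [Fin.sum_univ_succ]
      simp only [Fin.cons_zero, Fin.cons_succ, hT, Pi.sub_apply, Pi.mul_apply, sub_mul,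
        Finset.sum_sub_distrib, mul_sub, Finset.mul_sum, mul_assoc]
      ring
    refine ⟨Fin.cons b fun l => η l - b * ξ l, fun l => ?_, ?_, ?_⟩
    · refine Fin.cases ?_ (fun l => ?_) l
      · exact hbm
      · exact (hηm l).sub (hbm.mul (hξm l))
    · simp_rw [hsum]
      exact hη2.add hbT
    · simp_rw [hsum]
      set r' : Ω → ℝ := fun ω => r₁ ω - b ω * T ω with hr'
      have hr'2 : MemLp r' 2 μ := hr₁2.sub hbT
      have hrr : ∀ ω, r ω - ((∑ l, η l ω * S (Fin.succ l) ω) + b ω * T ω) = r' ω := fun ω => by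
        simp only [hr', hr₁]
        ring
      simp_rw [hrr]
      have hsucc : ∀ i : Fin k, μ[fun ω => S i.succ ω * r' ω | m₀] =ᵐ[μ] 0 := fun i => by
        have i1 : Integrable (fun ω => S i.succ ω * r₁ ω) μ := (hS' i).integrable_mul hr₁2
        have i2 : Integrable (fun ω => S i.succ ω * T ω) μ := (hS' i).integrable_mul hT2
        have i3 : Integrable (b * fun ω => S i.succ ω * T ω) μ :=
          ((hS' i).integrable_mul hbT).congr (Eventually.of_forall fun ω => by
            simp only [Pi.mul_apply]; ring)
        have e : (fun ω => S i.succ ω * r' ω)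
            = (fun ω => S i.succ ω * r₁ ω) - b * fun ω => S i.succ ω * T ω := by
          ext ω
          simp only [hr', Pi.sub_apply, Pi.mul_apply]
          ring
        rw [e]
        filter_upwards [condExp_sub i1 i3 m₀, condExp_mul_of_stronglyMeasurable_left hbm i3 i2,
          hη i, hξ i] with ω h1 h2 h3 h4
        rw [h1, Pi.sub_apply, h2, Pi.mul_apply, h3, h4]
        simp
      refine fun i => Fin.cases ?_ hsucc i
      -- `S 0` is the sum of `T` and a combination of the other variables
      have i1 : Integrable (fun ω => T ω * r' ω) μ := hT2.integrable_mul hr'2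
      have i2 : Integrable (fun ω => ∑ l, ξ l ω * (S (Fin.succ l) ω * r' ω)) μ :=
        (hξ2.integrable_mul hr'2).congr (Eventually.of_forall fun ω => by
          simp only [Pi.mul_apply, Finset.sum_mul, mul_assoc])
      have e : (fun ω => S 0 ω * r' ω)
          = (fun ω => T ω * r' ω) + fun ω => ∑ l, ξ l ω * (S (Fin.succ l) ω * r' ω) := by
        ext ω
        simp only [hT, Pi.add_apply, sub_mul, Finset.sum_mul, mul_assoc]
        ring
      rw [e]
      filter_upwards [condExp_add i1 i2 m₀, condExp_mul_sub_condCoeff_mul hm hr₁2 hT2,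
        condExp_sum_mul_of_integrable_sum (F := fun l ω => S (Fin.succ l) ω * r' ω) hm hξm
          (fun l => (hS' l).integrable_mul hr'2) i2,
        ae_all_iff.2 hsucc] with ω h1 h2 h3 h4
      rw [h1, Pi.add_apply, show μ[fun ω => T ω * r' ω | m₀] ω = _ from h2]
      rw [show μ[fun ω => ∑ l, ξ l ω * (S (Fin.succ l) ω * r' ω) | m₀] ω = _ from h3]
      simp only [Pi.zero_apply, zero_add]
      exact Finset.sum_eq_zero fun l _ => by rw [show μ[_ | m₀] ω = _ from h4 l]; simp

/-- Combinations of the `S l` with `m₀`-measurable coefficients are orthogonal to every variable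
that is conditionally orthogonal to all `S l`. -/
theorem integral_sum_mul_mul_eq_zero [IsFiniteMeasure μ] (hm : m₀ ≤ mΩ) {ι : Type*} [Fintype ι]
    {η S : ι → Ω → ℝ} {Z : Ω → ℝ} (hη : ∀ l, StronglyMeasurable[m₀] (η l))
    (hS : ∀ l, MemLp (S l) 2 μ) (hN : MemLp (fun ω => ∑ l, η l ω * S l ω) 2 μ)
    (hZ : MemLp Z 2 μ) (h0 : ∀ l, μ[fun ω => S l ω * Z ω | m₀] =ᵐ[μ] 0) :
    ∫ ω, (∑ l, η l ω * S l ω) * Z ω ∂μ = 0 := by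
  have e : (fun ω => (∑ l, η l ω * S l ω) * Z ω) = fun ω => ∑ l, η l ω * (S l ω * Z ω) := by
    ext ω
    simp only [Finset.sum_mul, mul_assoc]
  have hi : Integrable (fun ω => (∑ l, η l ω * S l ω) * Z ω) μ := hN.integrable_mul hZ
  rw [e] at hi ⊢
  rw [← integral_condExp hm]
  refine integral_eq_zero_of_ae ?_
  filter_upwards [condExp_sum_mul_of_integrable_sum (F := fun l ω => S l ω * Z ω) hm
    hη (fun l => (hS l).integrable_mul hZ) hi, ae_all_iff.2 h0] with ω h1 h2
  rw [h1]
  exact Finset.sum_eq_zero fun l _ => by rw [show μ[_ | m₀] ω = _ from h2 l]; simp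

/-- Pythagoras for the conditional projection. -/
theorem integral_sq_sub_eq_add [IsFiniteMeasure μ] (hm : m₀ ≤ mΩ) {ι : Type*} [Fintype ι]
    {η S : ι → Ω → ℝ} {r Z₀ Z : Ω → ℝ} (hη : ∀ l, StronglyMeasurable[m₀] (η l))
    (hS : ∀ l, MemLp (S l) 2 μ) (hr : MemLp r 2 μ) (hZ₀ : MemLp Z₀ 2 μ) (hZ : MemLp Z 2 μ)
    (hZ₀r : Z₀ =ᵐ[μ] fun ω => r ω - ∑ l, η l ω * S l ω)
    (h₀ : ∀ l, μ[fun ω => S l ω * Z₀ ω | m₀] =ᵐ[μ] 0)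
    (h : ∀ l, μ[fun ω => S l ω * Z ω | m₀] =ᵐ[μ] 0) :
    ∫ ω, (r ω - Z ω) ^ 2 ∂μ = ∫ ω, (r ω - Z₀ ω) ^ 2 ∂μ + ∫ ω, (Z₀ ω - Z ω) ^ 2 ∂μ := by
  have hN : MemLp (fun ω => ∑ l, η l ω * S l ω) 2 μ := by
    refine (memLp_congr_ae ?_).1 (hr.sub hZ₀)
    filter_upwards [hZ₀r] with ω hω
    rw [Pi.sub_apply, hω]
    ring
  have hd : MemLp (fun ω => Z₀ ω - Z ω) 2 μ := hZ₀.sub hZ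
  have h1 : ∫ ω, (∑ l, η l ω * S l ω) * (Z₀ ω - Z ω) ∂μ = 0 := by
    refine integral_sum_mul_mul_eq_zero hm hη hS hN hd fun l => ?_
    have i1 : Integrable (fun ω => S l ω * Z₀ ω) μ := (hS l).integrable_mul hZ₀
    have i2 : Integrable (fun ω => S l ω * Z ω) μ := (hS l).integrable_mul hZ
    have e : (fun ω => S l ω * (Z₀ ω - Z ω)) = (fun ω => S l ω * Z₀ ω) - fun ω => S l ω * Z ω := by
      ext ω
      simp only [Pi.sub_apply]
      ring
    rw [e]
    filter_upwards [condExp_sub i1 i2 m₀, h₀ l, h l] with ω h1 h2 h3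
    rw [h1, Pi.sub_apply, h2, h3]
    simp
  have i1 : Integrable (fun ω => (r ω - Z₀ ω) ^ 2) μ := (hr.sub hZ₀).integrable_sq
  have i2 : Integrable (fun ω => (Z₀ ω - Z ω) ^ 2) μ := hd.integrable_sq
  have i3 : Integrable (fun ω => 2 * ((∑ l, η l ω * S l ω) * (Z₀ ω - Z ω))) μ :=
    (hN.integrable_mul hd).const_mul 2
  have e : ∫ ω, (r ω - Z ω) ^ 2 ∂μ = ∫ ω, (((r ω - Z₀ ω) ^ 2 + (Z₀ ω - Z ω) ^ 2)
      + 2 * ((∑ l, η l ω * S l ω) * (Z₀ ω - Z ω))) ∂μ := by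
    refine integral_congr_ae ?_
    filter_upwards [hZ₀r] with ω hω
    rw [hω]
    ring
  have i12 : Integrable (fun ω => (r ω - Z₀ ω) ^ 2 + (Z₀ ω - Z ω) ^ 2) μ := i1.add i2
  rw [e, integral_add i12 i3, integral_add i1 i2, integral_const_mul, h1]
  ring

theorem ae_eq_of_integral_sq_sub_le_zero {Z₀ Z : Ω → ℝ} (hZ₀ : MemLp Z₀ 2 μ) (hZ : MemLp Z 2 μ)
    (h : ∫ ω, (Z₀ ω - Z ω) ^ 2 ∂μ ≤ 0) : Z₀ =ᵐ[μ] Z := by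
  have h0 : ∫ ω, (Z₀ ω - Z ω) ^ 2 ∂μ = 0 :=
    le_antisymm h (integral_nonneg fun ω => sq_nonneg _)
  have := (integral_eq_zero_iff_of_nonneg (fun ω => sq_nonneg _)
    (hZ₀.sub hZ).integrable_sq).1 h0
  filter_upwards [this] with ω hω
  exact sub_eq_zero.1 (pow_eq_zero_iff two_ne_zero |>.1 hω)

end ConditionalProjection

/-! ### The cascade perturbation -/

section Cascade

variable {m n : ℕ}

theorem hasDerivAt_comp_eq_sum_partialDeriv {g : (Fin m ⊕ Fin n → ℝ) → ℝ}
    (hg : Differentiable ℝ g) {ψ : Fin m ⊕ Fin n → ℝ → ℝ} (hψ : ∀ k, Differentiable ℝ (ψ k))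
    (t : ℝ) : HasDerivAt (fun t => g fun k => ψ k t)
      (∑ k, partialDeriv g k (fun j => ψ j t) * deriv (ψ k) t) t := by
  have h1 : HasDerivAt (fun t k => ψ k t) (fun k => deriv (ψ k) t) t :=
    hasDerivAt_pi.2 fun k => (hψ k t).hasDerivAt
  have h2 := (hg fun k => ψ k t).hasFDerivAt.comp_hasDerivAt t h1
  have hs : (fun k => deriv (ψ k) t) = ∑ k, deriv (ψ k) t • (Pi.single k 1 : _ → ℝ) := by
    rw [← Finset.univ_sum_single fun k => deriv (ψ k) t]
    exact Finset.sum_congr rfl fun k _ => by rw [← Pi.single_smul, smul_eq_mul, mul_one]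
  refine h2.congr_deriv ?_
  rw [hs, map_sum]
  refine Finset.sum_congr rfl fun k _ => ?_
  rw [map_smul, smul_eq_mul, mul_comm, partialDeriv]

/-- The bound on `t h'(t)` makes `δ ↦ h (d (1 + δ))` Lipschitz on `[0, ∞)`, uniformly in `d`. -/
theorem abs_sub_le_of_abs_mul_deriv_le {h h' : ℝ → ℝ} (hh : ∀ t, HasDerivAt h (h' t) t) {C : ℝ}
    (hC : ∀ t, |t * h' t| ≤ C) (d : ℝ) {δ : ℝ} (hδ : 0 ≤ δ) :
    |h (d * (1 + δ)) - h d| ≤ C * δ := by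
  have hd : ∀ s ∈ Ici (0 : ℝ), HasDerivWithinAt (fun s => h (d * (1 + s)))
      (h' (d * (1 + s)) * d) (Ici 0) s := fun s _ => by
    have h1 : HasDerivAt (fun s : ℝ => d * (1 + s)) d s := by
      simpa using ((hasDerivAt_id s).const_add 1).const_mul d
    exact ((hh _).comp s h1).hasDerivWithinAt
  have hb : ∀ s ∈ Ici (0 : ℝ), ‖h' (d * (1 + s)) * d‖ ≤ C := fun s hs => by
    have hs' : 1 ≤ 1 + s := le_add_of_nonneg_right hs
    refine le_trans ?_ (hC (d * (1 + s)))
    rw [Real.norm_eq_abs, abs_mul, abs_mul, abs_mul, abs_of_nonneg (zero_le_one.trans hs'),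
      mul_comm, mul_right_comm]
    exact le_mul_of_one_le_right (by positivity) hs'
  have := (convex_Ici (0 : ℝ)).norm_image_sub_le_of_norm_hasDerivWithin_le hd hb
    (mem_Ici.2 le_rfl) (mem_Ici.2 hδ)
  simpa [abs_of_nonneg hδ] using this

theorem tendsto_difference_quotient_of_hasDerivAt {h : ℝ → ℝ} {h' d : ℝ}
    (hh : HasDerivAt h h' d) {δ : ℕ → ℝ} (hδ : ∀ j, 0 < δ j) (hδ0 : Tendsto δ atTop (𝓝 0)) :
    Tendsto (fun j => (h (d * (1 + δ j)) - h d) / δ j) atTop (𝓝 (d * h')) := by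
  have h1 : HasDerivAt (fun s : ℝ => d * (1 + s)) d 0 := by
    simpa using ((hasDerivAt_id (0 : ℝ)).const_add 1).const_mul d
  have hh' : HasDerivAt h h' (d * (1 + 0)) := by simpa using hh
  have h2 := hasDerivAt_iff_tendsto_slope.1 (hh'.comp (0 : ℝ) h1)
  have h3 : Tendsto δ atTop (𝓝[≠] 0) :=
    tendsto_nhdsWithin_iff.2 ⟨hδ0, Eventually.of_forall fun j => (hδ j).ne'⟩
  rw [mul_comm d]
  refine (h2.comp h3).congr fun j => ?_
  simp [slope_def_field]

variable {Ω : Type*} [MeasurableSpace Ω] {μ : Measure Ω}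
  {D : Ω → Fin m → ℝ} {X : Ω → Fin n → ℝ} {g : (Fin m ⊕ Fin n → ℝ) → ℝ} {i : Fin m}
  {V : Ω → Fin m ⊕ Fin n → ℝ} {Ψ : Fin m ⊕ Fin n → ℝ → (Fin m ⊕ Fin n → ℝ) → ℝ}

theorem measurable_covariates (hD : Measurable D) (hX : Measurable X) :
    Measurable (covariates D X) := by
  refine measurable_pi_iff.2 fun k => ?_
  rcases k with k | k
  · exact (measurable_pi_apply k).comp hD
  · exact (measurable_pi_apply k).comp hX

theorem measurable_response (hD : Measurable D) (hX : Measurable X) (hg : Differentiable ℝ g) :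
    Measurable (response D X g) :=
  hg.continuous.measurable.comp (measurable_covariates hD hX)

theorem measurable_perturbed (hD : Measurable D) (hg : Differentiable ℝ g) (hV : Measurable V)
    (hΨ : ∀ k, Measurable (Function.uncurry (Ψ k))) (δ : ℝ) :
    Measurable (perturbed D g i V Ψ δ) := by
  refine hg.continuous.measurable.comp (measurable_pi_iff.2 fun k => ?_)
  exact (hΨ k).comp ((((measurable_pi_apply i).comp hD).mul_const _).prodMk hV)

theorem aemeasurable_cascadeTerm (hD : Measurable D) (hX : Measurable X)
    (hrep : IsCascadeRep μ D X i V Ψ) (k : Fin m ⊕ Fin n) :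
    AEMeasurable (cascadeTerm D X g i V Ψ k) μ := by
  have hDi : Measurable fun ω => D ω i := (measurable_pi_apply i).comp hD
  have h1 : Measurable fun ω => partialDeriv g k (covariates D X ω) :=
    (measurable_fderiv_apply_const ℝ g _).comp (measurable_covariates hD hX)
  have h2 : AEMeasurable (fun ω => deriv (fun t => Ψ k t (V ω)) (D ω i)) μ := by
    set δ : ℕ → ℝ := fun j => 1 / ((j : ℝ) + 1) with hδ
    have hΨm : ∀ c : ℝ, Measurable fun ω => Ψ k (D ω i + c) (V ω) := fun c =>
      (hrep.measurable_Psi k).comp ((hDi.add_const c).prodMk hrep.measurable_V)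
    refine aemeasurable_of_tendsto_metrizable_ae atTop
      (f := fun j ω => (Ψ k (D ω i + δ j) (V ω) - Ψ k (D ω i + 0) (V ω)) / δ j)
      (fun j => (((hΨm (δ j)).sub (hΨm 0)).div_const (δ j)).aemeasurable) ?_
    have h3 : Tendsto δ atTop (𝓝[≠] 0) :=
      tendsto_nhdsWithin_iff.2 ⟨tendsto_one_div_add_atTop_nhds_zero_nat,
        Eventually.of_forall fun j => (Nat.one_div_pos_of_nat).ne'⟩
    filter_upwards [hrep.differentiable] with ω hω
    have h4 := hasDerivAt_iff_tendsto_slope_zero.1 (hω k (D ω i)).hasDerivAt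
    refine (h4.comp h3).congr fun j => ?_
    simp [div_eq_inv_mul]
  exact (hDi.aemeasurable.mul h1.aemeasurable).mul h2

/-- The cascade terms are bounded by `c`, almost surely along the whole path `t ↦ Ψ(t, V)`: the
upper bound in `CascadeIntegrability`, without the square. -/
def CascadeBound (μ : Measure Ω) (g : (Fin m ⊕ Fin n → ℝ) → ℝ) (V : Ω → Fin m ⊕ Fin n → ℝ)
    (Ψ : Fin m ⊕ Fin n → ℝ → (Fin m ⊕ Fin n → ℝ) → ℝ) (c : ℝ) : Prop :=
  ∀ᵐ ω ∂μ, ∀ (t : ℝ) (k : Fin m ⊕ Fin n),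
    |t * partialDeriv g k (fun j => Ψ j t (V ω)) * deriv (fun s => Ψ k s (V ω)) t| ≤ c

theorem abs_cascadeTerm_le (hrep : IsCascadeRep μ D X i V Ψ) {c : ℝ}
    (hc : CascadeBound μ g V Ψ c) (k : Fin m ⊕ Fin n) :
    ∀ᵐ ω ∂μ, |cascadeTerm D X g i V Ψ k ω| ≤ c := by
  filter_upwards [hc, hrep.repr] with ω hω hr
  have h1 : (fun j => Ψ j (D ω i) (V ω)) = covariates D X ω := funext hr
  have := hω (D ω i) k
  rwa [h1] at this

theorem abs_perturbed_sub_response_le (hg : Differentiable ℝ g)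
    (hrep : IsCascadeRep μ D X i V Ψ) {c : ℝ} (hc : CascadeBound μ g V Ψ c) {δ : ℝ}
    (hδ : 0 ≤ δ) : ∀ᵐ ω ∂μ, |perturbed D g i V Ψ δ ω - response D X g ω|
      ≤ (Fintype.card (Fin m ⊕ Fin n) * c) * δ := by
  filter_upwards [hc, hrep.repr, hrep.differentiable] with ω hω hr hd
  have h1 : (fun j => Ψ j (D ω i) (V ω)) = covariates D X ω := funext hr
  rw [response, ← h1]
  refine abs_sub_le_of_abs_mul_deriv_le
    (fun t => hasDerivAt_comp_eq_sum_partialDeriv hg (ψ := fun k t => Ψ k t (V ω)) hd t)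
    (fun t => ?_) (D ω i) hδ
  rw [Finset.mul_sum]
  refine (Finset.abs_sum_le_sum_abs _ _).trans ?_
  refine (Finset.sum_le_card_nsmul _ _ c fun k _ => ?_).trans (le_of_eq ?_)
  · rw [← mul_assoc]
    exact hω t k
  · simp

theorem tendsto_perturbed_difference_quotient (hg : Differentiable ℝ g)
    (hrep : IsCascadeRep μ D X i V Ψ) {δ : ℕ → ℝ} (hδ : ∀ j, 0 < δ j)
    (hδ0 : Tendsto δ atTop (𝓝 0)) :
    ∀ᵐ ω ∂μ, Tendsto (fun j => (perturbed D g i V Ψ (δ j) ω - response D X g ω) / δ j) atTop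
      (𝓝 (∑ k, cascadeTerm D X g i V Ψ k ω)) := by
  filter_upwards [hrep.repr, hrep.differentiable] with ω hr hd
  have h1 : (fun j => Ψ j (D ω i) (V ω)) = covariates D X ω := funext hr
  have h2 : ∑ k, cascadeTerm D X g i V Ψ k ω = D ω i *
      ∑ k, partialDeriv g k (fun j => Ψ j (D ω i) (V ω)) *
        deriv (fun t => Ψ k t (V ω)) (D ω i) := by
    rw [Finset.mul_sum]
    refine Finset.sum_congr rfl fun k _ => ?_
    rw [cascadeTerm, h1, mul_assoc]
  rw [h2, response, ← h1]
  exact tendsto_difference_quotient_of_hasDerivAt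
    (hasDerivAt_comp_eq_sum_partialDeriv hg (ψ := fun k t => Ψ k t (V ω)) hd (D ω i)) hδ hδ0

theorem CascadeIntegrability.exists_cascadeBound (h : CascadeIntegrability μ D X g i V Ψ) :
    ∃ c, CascadeBound μ g V Ψ c := by
  obtain ⟨_, c₂, _, _, h2, _⟩ := h
  refine ⟨Real.sqrt c₂, ?_⟩
  filter_upwards [h2] with ω hω t k
  exact Real.abs_le_sqrt (hω t k).le

end Cascade

/-! ### Fairness constraints and the optimization problem -/

section Fairness

variable {Ω : Type*} {m n : ℕ} {D : Ω → Fin m → ℝ} {X : Ω → Fin n → ℝ}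
  {g : (Fin m ⊕ Fin n → ℝ) → ℝ}

theorem sigmaX_le_sigmaDX : sigmaX X ≤ sigmaDX D X :=
  (measurable_snd.comp (comap_measurable fun ω => (D ω, X ω))).comap_le

theorem stronglyMeasurable_response (hg : Differentiable ℝ g) :
    StronglyMeasurable[sigmaDX D X] (response D X g) := by
  have h : Measurable fun p : (Fin m → ℝ) × (Fin n → ℝ) => g (Sum.elim p.1 p.2) := by
    refine hg.continuous.measurable.comp (measurable_pi_iff.2 fun k => ?_)
    rcases k with k | k
    · exact (measurable_pi_apply k).comp measurable_fst
    · exact (measurable_pi_apply k).comp measurable_snd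
  exact (h.comp (comap_measurable fun ω => (D ω, X ω))).stronglyMeasurable

theorem sigmaDX_le {mΩ : MeasurableSpace Ω} (hD : Measurable D) (hX : Measurable X) :
    sigmaDX D X ≤ mΩ :=
  (hD.prodMk hX).comap_le

variable [MeasurableSpace Ω] {μ : Measure Ω} [IsProbabilityMeasure μ]

/-- Since the response is a function of `(D, X)`, so is every realized weight. -/
theorem Weight.Admissible.stronglyMeasurable_realized {ℓ : Weight m n} (hℓ : ℓ.Admissible μ D X)
    (hg : Differentiable ℝ g) :
    StronglyMeasurable[sigmaDX D X] (ℓ.realized μ D X (response D X g)) := by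
  have hDX : Measurable[sigmaDX D X] fun ω => (D ω, X ω) := comap_measurable _
  have hX : Measurable[sigmaDX D X] X := measurable_snd.comp hDX
  have hY : Measurable[sigmaDX D X] (response D X g) :=
    (stronglyMeasurable_response hg).measurable
  have hr : Measurable[sigmaDX D X] fun ω => (X ω, condRank μ X (response D X g) ω) :=
    hX.prodMk ((measurable_uncurry_cdf (condDistrib (response D X g) X μ)).comp (hX.prodMk hY))
  exact ((hℓ.measurable_rank.comp hr).add (hℓ.measurable_state.comp hDX)).stronglyMeasurable

theorem admissible_const {γ : ℝ → ℝ} (hX : Measurable X) (hγ : Measurable γ)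
    (hγ2 : MemLp γ 2 (volume.restrict (Ioo 0 1))) :
    (Weight.const γ : Weight m n).Admissible μ D X where
  measurable_rank := hγ.comp measurable_snd
  measurable_state := measurable_const
  memLp_rank := by
    have := Measure.isProbabilityMeasure_map (μ := μ) hX.aemeasurable
    exact hγ2.comp_snd (μ.map X)
  memLp_state := MemLp.zero

theorem realized_const (γ : ℝ → ℝ) (Y : Ω → ℝ) :
    (Weight.const γ : Weight m n).realized μ D X Y = fun ω => γ (condRank μ X Y ω) := by
  ext ω
  simp [Weight.realized, Weight.const]

/-- Every square-integrable function of `(D, X)` is the realization of an admissible weight that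
depends on the covariates only. -/
theorem exists_admissible_realized_ae_eq (Y : Ω → ℝ)
    {Z : Ω → ℝ} (hZ : AEStronglyMeasurable[sigmaDX D X] Z μ) (hZ2 : MemLp Z 2 μ) :
    ∃ ℓ : Weight m n, ℓ.Admissible μ D X ∧ ℓ.realized μ D X Y =ᵐ[μ] Z := by
  obtain ⟨Z', hZ'm, hZ'⟩ := hZ
  obtain ⟨w, hw, hwZ⟩ := hZ'm.measurable.exists_eq_measurable_comp
  have hwZ' : (fun ω => w (D ω, X ω)) =ᵐ[μ] Z := by
    filter_upwards [hZ'] with ω hω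
    rw [hω, hwZ]
    rfl
  refine ⟨⟨fun _ _ => 0, fun t x => w (t, x)⟩, ⟨measurable_const, hw, MemLp.zero, ?_⟩, ?_⟩
  · exact (memLp_congr_ae hwZ').2 hZ2
  · refine EventuallyEq.trans (Eventually.of_forall fun ω => ?_) hwZ'
    exact zero_add _

section Sensitivity

variable {i : Fin m} {V : Ω → Fin m ⊕ Fin n → ℝ}
  {Ψ : Fin m ⊕ Fin n → ℝ → (Fin m ⊕ Fin n → ℝ) → ℝ}

theorem memLp_cascadeTerm (hD : Measurable D) (hX : Measurable X)
    (hrep : IsCascadeRep μ D X i V Ψ) (hint : CascadeIntegrability μ D X g i V Ψ)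
    (k : Fin m ⊕ Fin n) (p : ENNReal) : MemLp (cascadeTerm D X g i V Ψ k) p μ := by
  obtain ⟨c, hc⟩ := hint.exists_cascadeBound
  exact MemLp.of_bound (aemeasurable_cascadeTerm hD hX hrep k).aestronglyMeasurable c
    (abs_cascadeTerm_le hrep hc k)

theorem memLp_sum_cascadeTerm (hD : Measurable D) (hX : Measurable X)
    (hrep : IsCascadeRep μ D X i V Ψ) (hint : CascadeIntegrability μ D X g i V Ψ)
    (p : ENNReal) : MemLp (fun ω => ∑ k, cascadeTerm D X g i V Ψ k ω) p μ :=
  memLp_finsetSum _ fun k _ => memLp_cascadeTerm hD hX hrep hint k p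

theorem memLp_cascadeDirection (hD : Measurable D) (hX : Measurable X)
    (hrep : IsCascadeRep μ D X i V Ψ) (hint : CascadeIntegrability μ D X g i V Ψ) :
    MemLp (cascadeDirection μ D X g i V Ψ) 2 μ :=
  (memLp_sum_cascadeTerm hD hX hrep hint 2).condExp (by norm_num)

/-- Against functions of `(D, X)`, the cascade direction may replace the sum of the cascade terms
(tower property). -/
theorem condExp_sum_cascadeTerm_mul (hD : Measurable D) (hX : Measurable X)
    (hrep : IsCascadeRep μ D X i V Ψ) (hint : CascadeIntegrability μ D X g i V Ψ) {R : Ω → ℝ}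
    (hR : StronglyMeasurable[sigmaDX D X] R) (hR2 : MemLp R 2 μ) :
    μ[fun ω => (∑ k, cascadeTerm D X g i V Ψ k ω) * R ω | sigmaX X] =ᵐ[μ]
      μ[fun ω => cascadeDirection μ D X g i V Ψ ω * R ω | sigmaX X] := by
  have hS := memLp_sum_cascadeTerm hD hX hrep hint 2
  have h1 : μ[(fun ω => ∑ k, cascadeTerm D X g i V Ψ k ω) * R | sigmaDX D X] =ᵐ[μ]
      μ[fun ω => ∑ k, cascadeTerm D X g i V Ψ k ω | sigmaDX D X] * R :=
    condExp_mul_of_stronglyMeasurable_right hR (hS.integrable_mul hR2)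
      (hS.integrable (by norm_num))
  exact (condExp_condExp_of_le sigmaX_le_sigmaDX (sigmaDX_le hD hX)).symm.trans
    (condExp_congr_ae h1)

theorem condExp_sum_cascadeTerm_mul_eq_sum (hD : Measurable D) (hX : Measurable X)
    (hrep : IsCascadeRep μ D X i V Ψ) (hint : CascadeIntegrability μ D X g i V Ψ) {R : Ω → ℝ}
    (hR2 : MemLp R 2 μ) :
    μ[fun ω => (∑ k, cascadeTerm D X g i V Ψ k ω) * R ω | sigmaX X] =ᵐ[μ]
      fun ω => ∑ k, (μ[fun ω' => cascadeTerm D X g i V Ψ k ω' * R ω' | sigmaX X]) ω := by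
  have h1 : (fun ω => (∑ k, cascadeTerm D X g i V Ψ k ω) * R ω)
      = ∑ k, fun ω => cascadeTerm D X g i V Ψ k ω * R ω := by
    ext ω
    simp only [Finset.sum_apply, Finset.sum_mul]
  rw [h1]
  refine (condExp_finsetSum (fun k _ =>
    (memLp_cascadeTerm hD hX hrep hint k 2).integrable_mul hR2) _).trans ?_
  exact Eventually.of_forall fun ω => Finset.sum_apply _ _ _

/-- Existence of the cascade sensitivity of an admissible decision rule, and its value. -/
theorem hasCascadeSensitivity_of_admissible {ℓ : Weight m n} (hℓ : ℓ.Admissible μ D X)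
    (hD : Measurable D) (hX : Measurable X) (hg : Differentiable ℝ g)
    (hY : MemLp (response D X g) 2 μ)
    (hU : ∀ᵐ x ∂(μ.map X), NullSingletonClass (condDistrib (response D X g) X μ x))
    (hrep : IsCascadeRep μ D X i V Ψ) (hint : CascadeIntegrability μ D X g i V Ψ) :
    HasCascadeSensitivity μ D X g i V Ψ ℓ
      (μ[fun ω => (∑ k, cascadeTerm D X g i V Ψ k ω) * ℓ.realized μ D X (response D X g) ω |
        sigmaX X]) := by
  obtain ⟨c, hc⟩ := hint.exists_cascadeBound
  exact fun δ hδ hδ0 => tendsto_decisionRule_difference_quotient hℓ hD hX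
    (measurable_response hD hX hg) hY hU
    (fun j => (measurable_perturbed hD hg hrep.measurable_V hrep.measurable_Psi _).aemeasurable)
    (memLp_sum_cascadeTerm hD hX hrep hint 2).1.aemeasurable hδ hδ0
    (fun j => abs_perturbed_sub_response_le hg hrep hc (hδ j).le)
    (tendsto_perturbed_difference_quotient hg hrep hδ hδ0)

/-- A rule is marginally fair exactly if its realized weight is conditionally orthogonal to the
cascade direction. -/
theorem isCascadeFair_iff {ℓ : Weight m n} (hℓ : ℓ.Admissible μ D X)
    (hD : Measurable D) (hX : Measurable X) (hg : Differentiable ℝ g)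
    (hY : MemLp (response D X g) 2 μ)
    (hU : ∀ᵐ x ∂(μ.map X), NullSingletonClass (condDistrib (response D X g) X μ x))
    (hrep : IsCascadeRep μ D X i V Ψ) (hint : CascadeIntegrability μ D X g i V Ψ) :
    IsCascadeFair μ D X g i V Ψ ℓ ↔
      μ[fun ω => cascadeDirection μ D X g i V Ψ ω * ℓ.realized μ D X (response D X g) ω |
        sigmaX X] =ᵐ[μ] 0 := by
  have hsens := hasCascadeSensitivity_of_admissible hℓ hD hX hg hY hU hrep hint
  have htower := condExp_sum_cascadeTerm_mul hD hX hrep hint (hℓ.stronglyMeasurable_realized hg)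
    (hℓ.memLp_realized hX (measurable_response hD hX hg) hU)
  constructor
  · intro hfair
    have hδ : ∀ j : ℕ, (0 : ℝ) < 1 / ((j : ℝ) + 1) := fun j => Nat.one_div_pos_of_nat
    filter_upwards [hfair _ hδ tendsto_one_div_add_atTop_nhds_zero_nat,
      hsens _ hδ tendsto_one_div_add_atTop_nhds_zero_nat, htower] with ω h1 h2 h3
    rw [← h3]
    exact tendsto_nhds_unique h2 h1
  · intro h δ hδ hδ0
    filter_upwards [hsens δ hδ hδ0, htower, h] with ω h1 h2 h3
    rw [h2, h3] at h1
    exact h1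

theorem condExp_cascadeDirection_mul_response (hD : Measurable D) (hX : Measurable X)
    (hg : Differentiable ℝ g) (hY : MemLp (response D X g) 2 μ)
    (hrep : IsCascadeRep μ D X i V Ψ) (hint : CascadeIntegrability μ D X g i V Ψ) :
    μ[fun ω => cascadeDirection μ D X g i V Ψ ω * response D X g ω | sigmaX X] =ᵐ[μ]
      fun ω => ∑ k, (μ[fun ω' => response D X g ω' * cascadeTerm D X g i V Ψ k ω' |
        sigmaX X]) ω := by
  refine (condExp_sum_cascadeTerm_mul hD hX hrep hint
    (stronglyMeasurable_response hg) hY).symm.trans ((condExp_sum_cascadeTerm_mul_eq_sum hD hX hrep hint hY).trans ?_)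
  simp_rw [mul_comm]
  rfl

end Sensitivity

section Optimization

variable {ι : Type*} [Fintype ι] {S η : ι → Ω → ℝ} {Fair : Weight m n → Prop} {γ : ℝ → ℝ}

/-- The optimization problem under finitely many constraints of conditional orthogonality is solved
exactly by the weights whose realization is the conditional projection of `γ(U)`. -/
theorem exists_isOptimalWeight_and_iff (hD : Measurable D) (hX : Measurable X)
    (hg : Differentiable ℝ g)
    (hU : ∀ᵐ x ∂(μ.map X), NullSingletonClass (condDistrib (response D X g) X μ x))
    (hγ : Measurable γ) (hγ2 : MemLp γ 2 (volume.restrict (Ioo 0 1)))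
    (hS : ∀ l, MemLp (S l) 2 μ) (hSm : ∀ l, StronglyMeasurable[sigmaDX D X] (S l))
    (hFair : ∀ ℓ : Weight m n, ℓ.Admissible μ D X → (Fair ℓ ↔
      ∀ l, μ[fun ω => S l ω * ℓ.realized μ D X (response D X g) ω | sigmaX X] =ᵐ[μ] 0))
    (hη : ∀ l, StronglyMeasurable[sigmaX X] (η l))
    (hN : MemLp (fun ω => ∑ l, η l ω * S l ω) 2 μ)
    (h0 : ∀ l, μ[fun ω => S l ω * (γ (condRank μ X (response D X g) ω)
      - ∑ l, η l ω * S l ω) | sigmaX X] =ᵐ[μ] 0) :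
    (∃ ℓ, IsOptimalWeight μ D X (response D X g) γ Fair ℓ) ∧
      ∀ ℓ, IsOptimalWeight μ D X (response D X g) γ Fair ℓ ↔ ℓ.Admissible μ D X ∧
        ℓ.realized μ D X (response D X g) =ᵐ[μ]
          fun ω => γ (condRank μ X (response D X g) ω) - ∑ l, η l ω * S l ω := by
  have hYm := measurable_response hD hX hg
  have hγa : (Weight.const γ : Weight m n).Admissible μ D X := admissible_const hX hγ hγ2
  have hΓ2 := hγa.memLp_realized hX hYm hU
  have hΓm := hγa.stronglyMeasurable_realized hg
  rw [realized_const] at hΓ2 hΓm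
  have hZ2 : MemLp (fun ω => γ (condRank μ X (response D X g) ω) - ∑ l, η l ω * S l ω) 2 μ :=
    hΓ2.sub hN
  have hZm : StronglyMeasurable[sigmaDX D X]
      (fun ω => γ (condRank μ X (response D X g) ω) - ∑ l, η l ω * S l ω) :=
    hΓm.sub (Finset.stronglyMeasurable_fun_sum _ fun l _ =>
      ((hη l).mono sigmaX_le_sigmaDX).mul (hSm l))
  -- Pythagoras relative to any weight realizing the projection
  have hfair : ∀ ℓ : Weight m n, ℓ.Admissible μ D X →
      (ℓ.realized μ D X (response D X g) =ᵐ[μ]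
        fun ω => γ (condRank μ X (response D X g) ω) - ∑ l, η l ω * S l ω) → Fair ℓ := by
    intro ℓ hℓ hr
    refine (hFair ℓ hℓ).2 fun l => (condExp_congr_ae ?_).trans (h0 l)
    filter_upwards [hr] with ω hω
    rw [hω]
  have hpyth : ∀ ℓ ℓ' : Weight m n, ℓ.Admissible μ D X →
      (ℓ.realized μ D X (response D X g) =ᵐ[μ]
        fun ω => γ (condRank μ X (response D X g) ω) - ∑ l, η l ω * S l ω) →
      ℓ'.Admissible μ D X → Fair ℓ' →
      weightCost μ D X (response D X g) γ ℓ' = weightCost μ D X (response D X g) γ ℓ +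
        ∫ ω, (ℓ.realized μ D X (response D X g) ω
          - ℓ'.realized μ D X (response D X g) ω) ^ 2 ∂μ := by
    intro ℓ ℓ' hℓ hr hℓ' hf
    exact integral_sq_sub_eq_add hX.comap_le hη hS hΓ2 (hℓ.memLp_realized hX hYm hU)
      (hℓ'.memLp_realized hX hYm hU) hr ((hFair ℓ hℓ).1 (hfair ℓ hℓ hr)) ((hFair ℓ' hℓ').1 hf)
  have hopt : ∀ ℓ : Weight m n, ℓ.Admissible μ D X →
      (ℓ.realized μ D X (response D X g) =ᵐ[μ]
        fun ω => γ (condRank μ X (response D X g) ω) - ∑ l, η l ω * S l ω) →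
      IsOptimalWeight μ D X (response D X g) γ Fair ℓ := by
    refine fun ℓ hℓ hr => ⟨hℓ, hfair ℓ hℓ hr, fun ℓ' hℓ' hf => ?_⟩
    rw [hpyth ℓ ℓ' hℓ hr hℓ' hf]
    exact le_add_of_nonneg_right (integral_nonneg fun ω => sq_nonneg _)
  obtain ⟨ℓ₀, hℓ₀, hr₀⟩ := exists_admissible_realized_ae_eq (response D X g)
    hZm.aestronglyMeasurable hZ2
  refine ⟨⟨ℓ₀, hopt ℓ₀ hℓ₀ hr₀⟩, fun ℓ => ⟨fun h => ⟨h.1, ?_⟩, fun h => hopt ℓ h.1 h.2⟩⟩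
  have h1 := hpyth ℓ₀ ℓ hℓ₀ hr₀ h.1 h.2.1
  have h2 := h.2.2 ℓ₀ hℓ₀ (hfair ℓ₀ hℓ₀ hr₀)
  exact (ae_eq_of_integral_sq_sub_le_zero (hℓ₀.memLp_realized hX hYm hU)
    (h.1.memLp_realized hX hYm hU) (by linarith)).symm.trans hr₀

/-- An adjustment of `γ(U)` by a combination of the `S l` with coefficients depending on `X` shifts
the decision rule by the same combination of the conditional means of `S l` times the response. -/
theorem decisionRule_ae_eq_sub_sum (hD : Measurable D) (hX : Measurable X)
    (hg : Differentiable ℝ g) (hY : MemLp (response D X g) 2 μ)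
    (hU : ∀ᵐ x ∂(μ.map X), NullSingletonClass (condDistrib (response D X g) X μ x))
    (hγ : Measurable γ) (hγ2 : MemLp γ 2 (volume.restrict (Ioo 0 1)))
    (hS : ∀ l, MemLp (S l) 2 μ) (hη : ∀ l, StronglyMeasurable[sigmaX X] (η l))
    {ℓ : Weight m n} (hℓ : ℓ.Admissible μ D X)
    (hr : ℓ.realized μ D X (response D X g) =ᵐ[μ]
      fun ω => γ (condRank μ X (response D X g) ω) - ∑ l, η l ω * S l ω) :
    decisionRule μ D X ℓ (response D X g) =ᵐ[μ] fun ω =>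
      decisionRule μ D X (Weight.const γ) (response D X g) ω
        - ∑ l, η l ω * (μ[fun ω' => S l ω' * response D X g ω' | sigmaX X]) ω := by
  have hYm := measurable_response hD hX hg
  have hγa : (Weight.const γ : Weight m n).Admissible μ D X := admissible_const hX hγ hγ2
  have hΓ2 := hγa.memLp_realized hX hYm hU
  have hR2 := hℓ.memLp_realized hX hYm hU
  have e1 := decisionRule_ae_eq_condExp hℓ hX hYm hY hU
  have e2 := decisionRule_ae_eq_condExp hγa hX hYm hY hU
  rw [realized_const] at hΓ2 e2
  have hN : MemLp (fun ω => ∑ l, η l ω * S l ω) 2 μ := by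
    refine (memLp_congr_ae ?_).1 (hΓ2.sub hR2)
    filter_upwards [hr] with ω hω
    rw [Pi.sub_apply, hω]
    ring
  have i1 : Integrable (fun ω => response D X g ω * γ (condRank μ X (response D X g) ω)) μ :=
    hY.integrable_mul hΓ2
  have i2 : Integrable (fun ω => ∑ l, η l ω * (S l ω * response D X g ω)) μ :=
    (hN.integrable_mul hY).congr (Eventually.of_forall fun ω => by
      simp only [Pi.mul_apply, Finset.sum_mul, mul_assoc])
  have e3 : μ[fun ω => response D X g ω * ℓ.realized μ D X (response D X g) ω | sigmaX X] =ᵐ[μ]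
      μ[(fun ω => response D X g ω * γ (condRank μ X (response D X g) ω))
        - fun ω => ∑ l, η l ω * (S l ω * response D X g ω) | sigmaX X] := by
    refine condExp_congr_ae ?_
    filter_upwards [hr] with ω hω
    rw [hω, Pi.sub_apply, mul_sub, Finset.mul_sum]
    congr 1
    exact Finset.sum_congr rfl fun l _ => by ring
  filter_upwards [e1, e2, e3, condExp_sub i1 i2 (sigmaX X),
    condExp_sum_mul_of_integrable_sum (F := fun l ω => S l ω * response D X g ω) hX.comap_le hη
      (fun l => (hS l).integrable_mul hY) i2] with ω e1 e2 e3 e4 e5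
  rw [e1, e2, e3, e4, Pi.sub_apply, e5]

end Optimization

end Fairness

/-! ### The optimal marginally fair weights -/

theorem proposition5p3 {Ω : Type*} [MeasurableSpace Ω] (μ : Measure Ω) [IsProbabilityMeasure μ]
    {m n : ℕ} (D : Ω → Fin m → ℝ) (X : Ω → Fin n → ℝ) (hD : Measurable D) (hX : Measurable X)
    (g : (Fin m ⊕ Fin n → ℝ) → ℝ) (hg : Differentiable ℝ g)
    (hY : MemLp (response D X g) 2 μ)
    (hU : ∀ᵐ x ∂(μ.map X), NullSingletonClass (condDistrib (response D X g) X μ x))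
    (γ : ℝ → ℝ) (hγ : Measurable γ) (hγ2 : MemLp γ 2 (volume.restrict (Ioo 0 1)))
    (V : Fin m → Ω → Fin m ⊕ Fin n → ℝ)
    (Ψ : Fin m → Fin m ⊕ Fin n → ℝ → (Fin m ⊕ Fin n → ℝ) → ℝ) :
    -- one protected covariate
    (∀ i : Fin m,
      (μ.map (fun ω => D ω i)).support = univ →
      IsCascadeRep μ D X i (V i) (Ψ i) →
      CascadeIntegrability μ D X g i (V i) (Ψ i) →
      ∃ L : Ω → ℝ,
        HasCascadeSensitivity μ D X g i (V i) (Ψ i) (Weight.const γ) L ∧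
        (L =ᵐ[μ] fun ω => ∑ k, (μ[fun ω' => cascadeTerm D X g i (V i) (Ψ i) k ω' *
            γ (condRank μ X (response D X g) ω') | sigmaX X]) ω) ∧
        (∃ ℓ : Weight m n, IsOptimalWeight μ D X (response D X g) γ
          (IsCascadeFair μ D X g i (V i) (Ψ i)) ℓ) ∧
        (∀ ℓ : Weight m n,
          IsOptimalWeight μ D X (response D X g) γ (IsCascadeFair μ D X g i (V i) (Ψ i)) ℓ ↔
            ℓ.Admissible μ D X ∧
            ℓ.realized μ D X (response D X g) =ᵐ[μ] fun ω =>
              γ (condRank μ X (response D X g) ω)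
                - L ω / (μ[fun ω' => (cascadeDirection μ D X g i (V i) (Ψ i) ω') ^ 2 | sigmaX X]) ω
                  * cascadeDirection μ D X g i (V i) (Ψ i) ω) ∧
        (∀ ℓ : Weight m n,
          IsOptimalWeight μ D X (response D X g) γ (IsCascadeFair μ D X g i (V i) (Ψ i)) ℓ →
            decisionRule μ D X ℓ (response D X g) =ᵐ[μ] fun ω =>
              decisionRule μ D X (Weight.const γ) (response D X g) ω
                - L ω / (μ[fun ω' => (cascadeDirection μ D X g i (V i) (Ψ i) ω') ^ 2 | sigmaX X]) ω
                  * ∑ k, (μ[fun ω' => response D X g ω' *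
                      cascadeTerm D X g i (V i) (Ψ i) k ω' | sigmaX X]) ω)) ∧
    -- all protected covariates simultaneously
    ((∀ i : Fin m,
      (μ.map (fun ω => D ω i)).support = univ ∧
      IsCascadeRep μ D X i (V i) (Ψ i) ∧
      CascadeIntegrability μ D X g i (V i) (Ψ i)) →
        (∃ ℓ : Weight m n, IsOptimalWeight μ D X (response D X g) γ
          (fun ℓ' => ∀ i, IsCascadeFair μ D X g i (V i) (Ψ i) ℓ') ℓ) ∧
        (∀ ℓ ℓ' : Weight m n,
          IsOptimalWeight μ D X (response D X g) γ
            (fun ℓ' => ∀ i, IsCascadeFair μ D X g i (V i) (Ψ i) ℓ') ℓ →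
          IsOptimalWeight μ D X (response D X g) γ
            (fun ℓ' => ∀ i, IsCascadeFair μ D X g i (V i) (Ψ i) ℓ') ℓ' →
          ℓ.realized μ D X (response D X g) =ᵐ[μ] ℓ'.realized μ D X (response D X g) ∧
          decisionRule μ D X ℓ (response D X g) =ᵐ[μ] decisionRule μ D X ℓ' (response D X g)) ∧
        (∃ η : Fin m → (Fin n → ℝ) → ℝ, (∀ l, Measurable (η l)) ∧
          ∀ ℓ : Weight m n,
            IsOptimalWeight μ D X (response D X g) γ
              (fun ℓ' => ∀ i, IsCascadeFair μ D X g i (V i) (Ψ i) ℓ') ℓ →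
            (ℓ.realized μ D X (response D X g) =ᵐ[μ] fun ω =>
              γ (condRank μ X (response D X g) ω)
                - ∑ l, η l (X ω) * cascadeDirection μ D X g l (V l) (Ψ l) ω) ∧
            (decisionRule μ D X ℓ (response D X g) =ᵐ[μ] fun ω =>
              decisionRule μ D X (Weight.const γ) (response D X g) ω
                - ∑ l, η l (X ω) * ∑ k, (μ[fun ω' => response D X g ω' *
                    cascadeTerm D X g l (V l) (Ψ l) k ω' | sigmaX X]) ω)) ∧
        -- conversely, any parameters for which the rule is fair give the optimal rule
        (∀ η : Fin m → (Fin n → ℝ) → ℝ, (∀ l, Measurable (η l)) →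
          ∀ ℓ : Weight m n, ℓ.Admissible μ D X →
            (∀ i, IsCascadeFair μ D X g i (V i) (Ψ i) ℓ) →
            (ℓ.realized μ D X (response D X g) =ᵐ[μ] fun ω =>
              γ (condRank μ X (response D X g) ω)
                - ∑ l, η l (X ω) * cascadeDirection μ D X g l (V l) (Ψ l) ω) →
            IsOptimalWeight μ D X (response D X g) γ
              (fun ℓ' => ∀ i, IsCascadeFair μ D X g i (V i) (Ψ i) ℓ') ℓ ∧
            (decisionRule μ D X ℓ (response D X g) =ᵐ[μ] fun ω =>
              decisionRule μ D X (Weight.const γ) (response D X g) ω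
                - ∑ l, η l (X ω) * ∑ k, (μ[fun ω' => response D X g ω' *
                    cascadeTerm D X g l (V l) (Ψ l) k ω' | sigmaX X]) ω))) ∧
    -- the representation through conditional quantile functions
    (∀ (i : Fin m) (κ : Fin m ⊕ Fin n → Kernel ℝ ℝ),
      IsCascadeRep μ D X i (V i) (Ψ i) →
      IsQuantileRep μ D X i (V i) (Ψ i) κ →
      ∀ k,
        (μ[fun ω => response D X g ω * cascadeTerm D X g i (V i) (Ψ i) k ω | sigmaX X] =ᵐ[μ]
          μ[fun ω => response D X g ω * quantileTerm D X g i (V i) κ k ω | sigmaX X]) ∧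
        (μ[fun ω => cascadeTerm D X g i (V i) (Ψ i) k ω *
              γ (condRank μ X (response D X g) ω) | sigmaX X] =ᵐ[μ]
          μ[fun ω => quantileTerm D X g i (V i) κ k ω *
              γ (condRank μ X (response D X g) ω) | sigmaX X])) := by
  have hYm := measurable_response hD hX hg
  have hγa : (Weight.const γ : Weight m n).Admissible μ D X := admissible_const hX hγ hγ2
  have hΓ2 := hγa.memLp_realized hX hYm hU
  have hΓm := hγa.stronglyMeasurable_realized hg
  rw [realized_const] at hΓ2 hΓm
  refine ⟨fun i _ hrep hint => ?_, fun hall => ?_, fun i κ hrep hq k => ?_⟩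
  · -- the projection onto a single direction has an explicit coefficient
    set S := cascadeDirection μ D X g i (V i) (Ψ i) with hSdef
    have hS2 : MemLp S 2 μ := memLp_cascadeDirection hD hX hrep hint
    have hsens := hasCascadeSensitivity_of_admissible hγa hD hX hg hY hU hrep hint
    rw [realized_const] at hsens
    set L := μ[fun ω => (∑ k, cascadeTerm D X g i (V i) (Ψ i) k ω) *
      γ (condRank μ X (response D X g) ω) | sigmaX X] with hL
    have hLS := condExp_sum_cascadeTerm_mul hD hX hrep hint hΓm hΓ2
    set b := condCoeff (sigmaX X) μ (fun ω => γ (condRank μ X (response D X g) ω)) S with hb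
    have hbm : StronglyMeasurable[sigmaX X] b := stronglyMeasurable_condCoeff _ _
    have hbL : b =ᵐ[μ] fun ω => L ω / (μ[fun ω' => S ω' ^ 2 | sigmaX X]) ω := by
      filter_upwards [hLS] with ω hω
      rw [hL, hω]
      rfl
    have hbS := memLp_condCoeff_mul hX.comap_le hΓ2 hS2
    have h0 := condExp_mul_sub_condCoeff_mul hX.comap_le hΓ2 hS2
    obtain ⟨hex, hiff⟩ := exists_isOptimalWeight_and_iff (ι := Unit) (S := fun _ => S)
      (η := fun _ => b) (Fair := IsCascadeFair μ D X g i (V i) (Ψ i)) hD hX hg hU hγ hγ2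
      (fun _ => hS2) (fun _ => stronglyMeasurable_condExp)
      (fun ℓ hℓ => by simpa using isCascadeFair_iff hℓ hD hX hg hY hU hrep hint)
      (fun _ => hbm) (by simpa using hbS) (fun _ => by simpa using h0)
    have hform : (fun ω => γ (condRank μ X (response D X g) ω) - ∑ _l : Unit, b ω * S ω) =ᵐ[μ]
        fun ω => γ (condRank μ X (response D X g) ω)
          - L ω / (μ[fun ω' => S ω' ^ 2 | sigmaX X]) ω * S ω := by
      filter_upwards [hbL] with ω hω
      simp [hω]
    refine ⟨L, hsens, condExp_sum_cascadeTerm_mul_eq_sum hD hX hrep hint hΓ2, hex,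
      fun ℓ => (hiff ℓ).trans (and_congr_right fun _ => ⟨fun h => h.trans hform,
        fun h => h.trans hform.symm⟩), fun ℓ hℓ => ?_⟩
    have hd := decisionRule_ae_eq_sub_sum (ι := Unit) (S := fun _ => S) (η := fun _ => b) hD hX hg
      hY hU hγ hγ2 (fun _ => hS2) (fun _ => hbm) hℓ.1 ((hiff ℓ).1 hℓ).2
    filter_upwards [hd, hbL, condExp_cascadeDirection_mul_response hD hX hg hY hrep hint]
      with ω h1 h2 h3
    rw [h1]
    simp only [Finset.univ_unique, Finset.sum_const, Finset.card_singleton, one_smul]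
    rw [h2, ← h3]
  · have hS2 : ∀ l, MemLp (cascadeDirection μ D X g l (V l) (Ψ l)) 2 μ := fun l =>
      memLp_cascadeDirection hD hX (hall l).2.1 (hall l).2.2
    have hSm : ∀ l, StronglyMeasurable[sigmaDX D X] (cascadeDirection μ D X g l (V l) (Ψ l)) :=
      fun l => stronglyMeasurable_condExp
    have hFair : ∀ ℓ : Weight m n, ℓ.Admissible μ D X →
        ((∀ i, IsCascadeFair μ D X g i (V i) (Ψ i) ℓ) ↔
          ∀ l, μ[fun ω => cascadeDirection μ D X g l (V l) (Ψ l) ω *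
            ℓ.realized μ D X (response D X g) ω | sigmaX X] =ᵐ[μ] 0) := fun ℓ hℓ =>
      forall_congr' fun l => isCascadeFair_iff hℓ hD hX hg hY hU (hall l).2.1 (hall l).2.2
    -- the decision rule of a weight in projection form
    have hrule : ∀ η : Fin m → (Fin n → ℝ) → ℝ, (∀ l, Measurable (η l)) →
        ∀ ℓ : Weight m n, ℓ.Admissible μ D X →
          (ℓ.realized μ D X (response D X g) =ᵐ[μ] fun ω =>
            γ (condRank μ X (response D X g) ω)
              - ∑ l, η l (X ω) * cascadeDirection μ D X g l (V l) (Ψ l) ω) →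
          decisionRule μ D X ℓ (response D X g) =ᵐ[μ] fun ω =>
            decisionRule μ D X (Weight.const γ) (response D X g) ω
              - ∑ l, η l (X ω) * ∑ k, (μ[fun ω' => response D X g ω' *
                  cascadeTerm D X g l (V l) (Ψ l) k ω' | sigmaX X]) ω := by
      intro η hη ℓ hℓ hr
      have hd := decisionRule_ae_eq_sub_sum (η := fun l ω => η l (X ω)) hD hX hg hY hU hγ hγ2 hS2
        (fun l => ((hη l).comp (comap_measurable X)).stronglyMeasurable) hℓ hr
      filter_upwards [hd, ae_all_iff.2 fun l => condExp_cascadeDirection_mul_response hD hX hg hY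
        (hall l).2.1 (hall l).2.2] with ω h1 h2
      rw [h1]
      simp only [h2]
    obtain ⟨η, hηm, hN, h0⟩ := exists_condExp_mul_sub_sum_eq_zero (m₀ := sigmaX X) hX.comap_le
      (fun l => cascadeDirection μ D X g l (V l) (Ψ l)) hS2 _ hΓ2
    obtain ⟨hex, hiff⟩ := exists_isOptimalWeight_and_iff hD hX hg hU hγ hγ2 hS2 hSm hFair hηm hN h0
    choose η' hη'm hη' using fun l => (hηm l).measurable.exists_eq_measurable_comp
    have hη'X : ∀ l ω, η l ω = η' l (X ω) := fun l ω => congrFun (hη' l) ω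
    simp only [hη'X] at hiff
    have hruleη := fun ℓ hℓ => hrule η' hη'm ℓ ((hiff ℓ).1 hℓ).1 ((hiff ℓ).1 hℓ).2
    refine ⟨hex, fun ℓ ℓ' hℓ hℓ' => ⟨?_, ?_⟩, ⟨η', hη'm, fun ℓ hℓ => ⟨?_, ?_⟩⟩, ?_⟩
    · exact ((hiff ℓ).1 hℓ).2.trans ((hiff ℓ').1 hℓ').2.symm
    · exact (hruleη ℓ hℓ).trans (hruleη ℓ' hℓ').symm
    · exact ((hiff ℓ).1 hℓ).2
    · exact hruleη ℓ hℓ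
    · intro ξ hξ ℓ hℓ hf hr
      have hξm : ∀ l, StronglyMeasurable[sigmaX X] fun ω => ξ l (X ω) := fun l =>
        ((hξ l).comp (comap_measurable X)).stronglyMeasurable
      have hNξ : MemLp
          (fun ω => ∑ l, ξ l (X ω) * cascadeDirection μ D X g l (V l) (Ψ l) ω) 2 μ := by
        refine (memLp_congr_ae ?_).1 (hΓ2.sub (hℓ.memLp_realized hX hYm hU))
        filter_upwards [hr] with ω hω
        rw [Pi.sub_apply, hω]
        ring
      have h0ξ : ∀ l, μ[fun ω => cascadeDirection μ D X g l (V l) (Ψ l) ω *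
          (γ (condRank μ X (response D X g) ω)
            - ∑ l, ξ l (X ω) * cascadeDirection μ D X g l (V l) (Ψ l) ω) | sigmaX X] =ᵐ[μ] 0 := by
        refine fun l => (condExp_congr_ae ?_).trans ((hFair ℓ hℓ).1 hf l)
        filter_upwards [hr] with ω hω
        rw [hω]
      exact ⟨((exists_isOptimalWeight_and_iff hD hX hg hU hγ hγ2 hS2 hSm hFair hξm hNξ h0ξ).2 ℓ).2
        ⟨hℓ, hr⟩, hrule ξ hξ ℓ hℓ hr⟩
  · have hterm : cascadeTerm D X g i (V i) (Ψ i) k =ᵐ[μ] quantileTerm D X g i (V i) κ k := by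
      filter_upwards [(hq k).2.2] with ω hω
      rw [cascadeTerm, quantileTerm, funext hω]
    constructor <;> refine condExp_congr_ae ?_ <;> filter_upwards [hterm] with ω hω <;> rw [hω]
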